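/- Notation. For a finite alphabet $\Sigma$, let $\mathscr T_\Sigma$ be the set of binary trees with leaves labelled in $\Sigma$ (a leaf has depth $0$), and let $\mathrm{str}(t)$ be the bracket representation of $t$: $\mathrm{str}(\sigma)=\sigma$ and $\mathrm{str}((t_1,t_2))=[\![\,\mathrm{str}(t_1)\,\mathrm{str}(t_2)\,]\!]$. For each position $i$ of $\mathrm{str}(t)$ that does not carry a closing bracket, let $\tau_i$ be the unique subtree of $t$ whose representation is a substring of $\mathrm{str}(t)$ starting at $i$; let $\mathcal I_t$ be the set of these positions. A weighted tree automaton $\mathcal A$ with $n$ states is given by $\alpha\in\mathbb R^n$, $\mathcal T\in\mathbb R^{n\times n\times n}$ and $(v_\sigma)_{\sigma\in\Sigma}$ in $\mathbb R^n$; its states are $\mu(\sigma)=v_\sigma$ and $\mu((t_1,t_2))_q=\sum_{i,j}\mathcal T_{qij}\,\mu(t_1)_i\,\mu(t_2)_j$. An $L$-layer transformer embeds every token by a token embedding concatenated with a positional encoding, then applies $L$ layers without residual connections, each a multi-head attention block with heads $\mathrm{softmax}(XW_QW_K^\top X^\top)XW_V$, whose outputs are concatenated and passed through a linear layer, followed by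 an MLP with one hidden layer applied to each position; its output is the first $n$ coordinates of the last embedding. It approximately simulates $\mathcal A$ at length $T$ with precision $\epsilon$ on a class of trees if $\big(\sum_{i\in\mathcal I_t}\|f(\mathrm{str}(t))_i-\mu(\tau_i)\|_2^2\big)^{1/2}<\epsilon$ for every tree $t$ of the class with $|\mathrm{str}(t)|\le T$. Theorem. There are a universal constant $C$, a universal dimension $p$ and, for every $T$, a positional encoding in $\mathbb R^p$ depending only on $T$, such that the following holds for every activation function that is $C^\infty$ and is not a polynomial of degree at most $3$, every finite alphabet $\Sigma$, every $n\ge 1$, every weighted tree automaton $\mathcal A$ with $n$ states over $\Sigma$, every $T$ and every $\epsilon>0$. In each case below, the transformer has embedding dimension (including the positional encoding) at most $Cn$, attention width at most $Cn$, MLP width at most $Cn^2$ (in particular $\mathcal O(n^3)$) and at most $C$ attention heads per layer. (1) For every $D\ge0$, some transformer with exactly $1+D$ layers approximately simulates $\mathcal A$ at length $T$ with precision $\epsilon$ on all trees of depth at most $D$. (2) Some transformer with at most $CT$ layers approximately simulates $\mathcal A$ at length $T$ with precision $\epsilon$ on all trees. (3) If $T\ge2$, then for every $\kappa\ge0$ some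 transformer with at most $C(\kappa+1)\log T$ layers approximately simulates $\mathcal A$ at length $T$ with precision $\epsilon$ on all trees of depth at most $\kappa\log T$ (balanced trees). -/

import Mathlib

open scoped ContDiff

/-- Binary trees whose leaves are labelled by symbols of `S`. -/
inductive LTree (S : Type*) where
  | leaf (a : S) : LTree S
  | node (l r : LTree S) : LTree S

/-- The input alphabet: the symbols of `S` and the two brackets. -/
inductive BSym (S : Type*) where
  | letter (a : S) : BSym S
  | opening : BSym S
  | closing : BSym S

/-- Is the symbol the closing bracket? -/
def BSym.isClosing {S : Type*} : BSym S → Bool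
  | .letter _ => false
  | .opening => false
  | .closing => true

namespace LTree

variable {S : Type*}

/-- Depth of a tree; a leaf has depth `0`. -/
def depth : LTree S → ℕ
  | leaf _ => 0
  | node l r => max l.depth r.depth + 1

/-- Bracket representation of a tree, commas omitted. -/
def str : LTree S → List (BSym S)
  | leaf a => [BSym.letter a]
  | node l r => BSym.opening :: (str l ++ (str r ++ [BSym.closing]))

/-- The (0-based) positions of `str t` that do not carry a closing bracket. -/
def starts (t : LTree S) : Finset (Fin t.str.length) :=
  Finset.univ.filter fun i => (t.str.get i).isClosing = false

theorem str_append_inj (s₁ s₂ : LTree S) :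
    ∀ u₁ u₂ : List (BSym S), s₁.str ++ u₁ = s₂.str ++ u₂ → s₁ = s₂ ∧ u₁ = u₂ := by
  induction s₁ generalizing s₂ with
  | leaf a =>
    intro u₁ u₂ h
    cases s₂ with
    | leaf b => simp [str] at h; exact ⟨by rw [h.1], h.2⟩
    | node l r => simp [str] at h
  | node l r ihl ihr =>
    intro u₁ u₂ h
    cases s₂ with
    | leaf b => simp [str] at h
    | node l' r' =>
      simp only [str, List.cons_append, List.append_assoc, List.cons.injEq, true_and] at h
      obtain ⟨e₁, h₁⟩ := ihl _ _ _ h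
      obtain ⟨e₂, h₂⟩ := ihr _ _ _ h₁
      simp at h₂
      exact ⟨by rw [e₁, e₂], h₂⟩

theorem exists_str_prefix (t : LTree S) :
    ∀ (i : ℕ) (hi : i < t.str.length), (t.str.get ⟨i, hi⟩).isClosing = false →
      ∃ s : LTree S, s.str <+: t.str.drop i := by
  induction t with
  | leaf a =>
    intro i hi _
    have : i = 0 := by simp [str] at hi; exact hi
    subst this
    exact ⟨leaf a, by simp⟩
  | node l r ihl ihr =>
    intro i hi h
    cases i with
    | zero => exact ⟨node l r, by simp⟩
    | succ k =>
      simp only [str, List.length_cons, List.length_append, List.length_nil] at hi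
      simp only [str, List.get_eq_getElem, List.getElem_cons_succ] at h
      simp only [str, List.drop_succ_cons]
      by_cases h1 : k < l.str.length
      · rw [List.getElem_append_left h1] at h
        obtain ⟨s, hs⟩ := ihl k h1 h
        refine ⟨s, ?_⟩
        rw [List.drop_append_of_le_length h1.le]
        exact hs.trans (List.prefix_append _ _)
      · push Not at h1
        obtain ⟨m, rfl⟩ := Nat.exists_eq_add_of_le h1
        rw [List.getElem_append_right h1] at h
        rw [List.drop_append]
        simp only [Nat.add_sub_cancel_left] at h ⊢
        rw [List.drop_eq_nil_of_le h1, List.nil_append]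
        by_cases h2 : m < r.str.length
        · rw [List.getElem_append_left h2] at h
          obtain ⟨s, hs⟩ := ihr m h2 h
          refine ⟨s, ?_⟩
          rw [List.drop_append_of_le_length h2.le]
          exact hs.trans (List.prefix_append _ _)
        · push Not at h2
          rw [List.getElem_append_right h2] at h
          simp [BSym.isClosing] at h

/-- Exactly one substring of `str t` that starts at a given non-closing position
is the representation of a tree. -/
theorem existsUnique_str_prefix (t : LTree S) (i : t.starts) :
    ∃! s : LTree S, s.str <+: t.str.drop i.1 := by
  obtain ⟨⟨i, hi⟩, h⟩ := i
  simp only [starts, Finset.mem_filter, Finset.mem_univ, true_and] at h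
  obtain ⟨s, hs⟩ := exists_str_prefix t i hi h
  refine ⟨s, hs, ?_⟩
  rintro s' ⟨u', hu'⟩
  obtain ⟨u, hu⟩ := hs
  exact (str_append_inj s' s u' u (hu'.trans hu.symm)).1

/-- The subtree of `t` that is represented by the substring starting at position `i`. -/
noncomputable def subtreeAt (t : LTree S) (i : t.starts) : LTree S :=
  (existsUnique_str_prefix t i).choose

end LTree

/-- Weighted tree automata with `n` states and real weights. -/
structure WTA (S : Type*) (n : ℕ) where
  final : Fin n → ℝ
  trans : Fin n → Fin n → Fin n → ℝ
  init : S → Fin n → ℝ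

namespace WTA

variable {S : Type*} {n : ℕ}

/-- The state reached on a tree: `μ (leaf a) = v_a`, and `μ (node l r)` contracts the second and
third modes of the transition tensor with `μ l` and `μ r`. -/
def mu (A : WTA S n) : LTree S → Fin n → ℝ
  | .leaf a => A.init a
  | .node l r => fun q => ∑ i, ∑ j, A.trans q i j * A.mu l i * A.mu r j

/-- The function computed by the automaton. -/
def value (A : WTA S n) (t : LTree S) : ℝ := ∑ q, A.final q * A.mu t q

end WTA

/-- Row-wise softmax. -/
noncomputable def rowSoftmax {m : ℕ} (M : Matrix (Fin m) (Fin m) ℝ) : Matrix (Fin m) (Fin m) ℝ :=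
  Matrix.of fun i j => Real.exp (M i j) / ∑ l, Real.exp (M i l)

/-- One attention head: query, key and value matrices. -/
structure AttnHead (d k : ℕ) where
  WQ : Matrix (Fin d) (Fin k) ℝ
  WK : Matrix (Fin d) (Fin k) ℝ
  WV : Matrix (Fin d) (Fin k) ℝ

/-- `softmax (X W_Q W_Kᵀ Xᵀ) X W_V`. -/
noncomputable def AttnHead.apply {d k m : ℕ} (H : AttnHead d k) (X : Matrix (Fin m) (Fin d) ℝ) :
    Matrix (Fin m) (Fin k) ℝ :=
  rowSoftmax (X * H.WQ * H.WK.transpose * X.transpose) * X * H.WV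

/-- One transformer layer: `h` attention heads of width `k`, the linear layer applied to their
concatenated outputs, and an MLP with one hidden layer of width `w`. -/
structure TLayer (d k h w : ℕ) where
  heads : Fin h → AttnHead d k
  WO : Matrix (Fin h × Fin k) (Fin d) ℝ
  W₁ : Matrix (Fin d) (Fin w) ℝ
  b₁ : Fin w → ℝ
  W₂ : Matrix (Fin w) (Fin d) ℝ
  b₂ : Fin d → ℝ

namespace TLayer

variable {d k h w m : ℕ}

/-- The multi-head attention block. -/
noncomputable def attn (Λ : TLayer d k h w) (X : Matrix (Fin m) (Fin d) ℝ) :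
    Matrix (Fin m) (Fin d) ℝ :=
  (Matrix.of fun i (c : Fin h × Fin k) => (Λ.heads c.1).apply X i c.2) * Λ.WO

/-- The feedforward block with activation `act`, applied to each row. -/
def mlp (act : ℝ → ℝ) (Λ : TLayer d k h w) (X : Matrix (Fin m) (Fin d) ℝ) :
    Matrix (Fin m) (Fin d) ℝ :=
  Matrix.of fun i c => (∑ u, act ((∑ a, X i a * Λ.W₁ a u) + Λ.b₁ u) * Λ.W₂ u c) + Λ.b₂ c

/-- The whole layer: attention, then MLP (no residual connections). -/
noncomputable def apply (act : ℝ → ℝ) (Λ : TLayer d k h w) (X : Matrix (Fin m) (Fin d) ℝ) :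
    Matrix (Fin m) (Fin d) ℝ :=
  Λ.mlp act (Λ.attn X)

end TLayer

/-- A transformer on strings over `S` and the brackets. Each token is embedded in `ℝ^(n + q)`; a
positional encoding in `ℝ^p` is appended to it. The first `n` coordinates of the last layer are
the output. -/
structure Transformer (S : Type*) (n p : ℕ) where
  q : ℕ
  attnWidth : ℕ
  numHeads : ℕ
  mlpWidth : ℕ
  tok : BSym S → Fin (n + q) → ℝ
  layers : List (TLayer (n + q + p) attnWidth numHeads mlpWidth)

namespace Transformer

variable {S : Type*} {n p : ℕ}

/-- The embedding dimension, positional encoding included. -/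
def embedDim (f : Transformer S n p) : ℕ := n + f.q + p

/-- The number of layers. -/
def depth (f : Transformer S n p) : ℕ := f.layers.length

/-- The initial embedding of a string. -/
def embed (f : Transformer S n p) (pos : ℕ → Fin p → ℝ) (x : List (BSym S)) :
    Matrix (Fin x.length) (Fin (n + f.q + p)) ℝ :=
  Matrix.of fun i => Fin.append (f.tok (x.get i)) (pos i)

/-- The sequence-to-sequence function computed by the transformer with activation `act` and
positional encoding `pos`. -/
noncomputable def eval (f : Transformer S n p) (act : ℝ → ℝ) (pos : ℕ → Fin p → ℝ)
    (x : List (BSym S)) : Matrix (Fin x.length) (Fin n) ℝ :=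
  Matrix.of fun i c =>
    (f.layers.foldl (fun X Λ => Λ.apply act X) (f.embed pos x)) i
      (Fin.castAdd p (Fin.castAdd f.q c))

/-- Embedding dimension and attention width at most `C n`, MLP width at most `C n²`, at most `C`
attention heads. -/
def SizeAtMost (f : Transformer S n p) (C : ℕ) : Prop :=
  f.embedDim ≤ C * n ∧ f.attnWidth ≤ C * n ∧ f.mlpWidth ≤ C * n ^ 2 ∧ f.numHeads ≤ C

end Transformer

/-- `F` approximately simulates `A` on the trees of the class `𝒯` with representation of length at
most `T`: on each of them the Frobenius norm of the error, over all positions at which a subtree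
starts, is less than `ε`. -/
def ApproxSimulatesOn {S : Type*} {n : ℕ} (𝒯 : Set (LTree S)) (A : WTA S n) (T : ℕ) (ε : ℝ)
    (F : (x : List (BSym S)) → Matrix (Fin x.length) (Fin n) ℝ) : Prop :=
  ∀ t ∈ 𝒯, t.str.length ≤ T →
    Real.sqrt (∑ i : t.starts, ∑ c, (F t.str i.1 c - A.mu (t.subtreeAt i) c) ^ 2) < ε

/-!
Every tree with a representation of length at most `T` over a finite alphabet belongs to a finite
set, so it is enough that the wanted embeddings are *pointwise limits* of embeddings computed by
transformers. Since layers are continuous, such limits can be taken one layer at a time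
(`closure_reachable_trans`), and one may compute with idealized layers.

The idealized layers are described by `tripleProducts_routedAttn_mem_closure`. Scaling the scores of
a head turns softmax into hard attention (`tendsto_rowSoftmax_hardmax`). If the third derivative of
the activation does not vanish at `x₀`, its mixed third difference at `x₀` with step tending to `0`
computes a product of three coordinates (`tendsto_thirdDifference`), so feedforward blocks can form
linear combinations of such products, with eight neurons for each of them.

The first layer computes the nesting depth ("height") of each position, up to a small error: a head
whose score is `-N⁻¹ (N²) ^ (j + 1 - i)`, a product of a function of `i` and one of `j`, averages
the bracket weights of the positions `j < i`, and the feedforward block multiplies the mean by `i`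
and also stores the square of the result. For a given `T` the base `N` can be chosen once and for
all (`exists_maskBase`), which is why the positional encoding depends on `T` only.

Each later layer evaluates the automaton one level further up (`limitRow_succ_mem_closure`). The
left child of the node at position `i` starts at `i + 1`. Its right child starts at the first `j > i + 1`
whose height exceeds that of `i` by one (`exists_rightChild`); this position is the strict maximum
of a score that is quadratic in the heights, hence bilinear in the embeddings once squares of
heights are stored (`rightScore_lt`). The error of the heights does not accumulate, because it only has to
leave the maximum in place. The feedforward block then forms the `n²` products of two states, gated
by the indicator of opening brackets, and adds the vector of the letter. After `1 + k` layers, the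
states of all subtrees of depth at most `k` are correct; the bounds for all trees and for balanced
trees follow by inserting `k = T - 1` and `k = ⌊κ log T⌋`.
-/

/-! ### Products of three inputs as limits of networks with one hidden layer -/

/-- If the third derivative of a smooth function vanishes everywhere, the function is a polynomial
of degree at most `2`. -/
theorem exists_iteratedDeriv_three_ne_zero {act : ℝ → ℝ} (hs : ContDiff ℝ ∞ act)
    (hp : ¬ ∃ P : Polynomial ℝ, P.natDegree ≤ 3 ∧ ∀ x, act x = P.eval x) :
    ∃ x₀, iteratedDeriv 3 act x₀ ≠ 0 := by
  by_contra! h0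
  apply hp
  have hd : ∀ m : ℕ, Differentiable ℝ (iteratedDeriv m act) := fun m =>
    hs.differentiable_iteratedDeriv m (by exact_mod_cast ENat.natCast_lt_top m)
  have hda : Differentiable ℝ act := by simpa using hd 0
  have e1 : ∀ x, iteratedDeriv 2 act x = iteratedDeriv 2 act 0 := fun x =>
    is_const_of_deriv_eq_zero (hd 2) (fun y => by rw [← iteratedDeriv_succ]; exact h0 y) x 0
  have e2 : ∀ x, iteratedDeriv 1 act x - iteratedDeriv 2 act 0 * x = iteratedDeriv 1 act 0 := by
    intro x
    have := is_const_of_deriv_eq_zero (f := fun x => iteratedDeriv 1 act x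
      - iteratedDeriv 2 act 0 * x) ((hd 1).sub (by fun_prop)) (fun y => by
        have h1 : HasDerivAt (iteratedDeriv 1 act) (iteratedDeriv 2 act y) y := by
          rw [iteratedDeriv_succ (n := 1)]; exact (hd 1 y).hasDerivAt
        have h2 := h1.sub ((hasDerivAt_id y).const_mul (iteratedDeriv 2 act 0))
        have h3 : deriv (fun x => iteratedDeriv 1 act x - iteratedDeriv 2 act 0 * x) y = _ :=
          h2.deriv
        rw [h3, e1 y, mul_one, sub_self]) x 0
    simpa using this
  have e3 : ∀ x, act x - (iteratedDeriv 2 act 0 / 2 * x ^ 2 + iteratedDeriv 1 act 0 * x)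
      = act 0 := by
    intro x
    have := is_const_of_deriv_eq_zero (f := fun x => act x -
      (iteratedDeriv 2 act 0 / 2 * x ^ 2 + iteratedDeriv 1 act 0 * x))
      (hda.sub (by fun_prop)) (fun y => by
        have h1 : HasDerivAt act (iteratedDeriv 1 act y) y := by
          rw [iteratedDeriv_one]; exact (hda y).hasDerivAt
        have h2 := h1.sub ((((hasDerivAt_pow 2 y).const_mul (iteratedDeriv 2 act 0 / 2))).add
          ((hasDerivAt_id y).const_mul (iteratedDeriv 1 act 0)))
        have h3 : deriv (fun x => act x -
          (iteratedDeriv 2 act 0 / 2 * x ^ 2 + iteratedDeriv 1 act 0 * x)) y = _ := h2.deriv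
        rw [h3, ← e2 y]
        ring) x 0
    simpa using this
  refine ⟨Polynomial.C (iteratedDeriv 2 act 0 / 2) * Polynomial.X ^ 2 +
    Polynomial.C (iteratedDeriv 1 act 0) * Polynomial.X + Polynomial.C (act 0), ?_, fun x => ?_⟩
  · exact Polynomial.natDegree_quadratic_le.trans (by norm_num)
  · simp only [Polynomial.eval_add, Polynomial.eval_mul, Polynomial.eval_C, Polynomial.eval_pow,
      Polynomial.eval_X]
    linarith [e3 x]

/-- The mixed third difference of `act` at `x₀` with step `h` in the directions `y 0`, `y 1`, `y 2`,
divided by `h ^ 3` times the third derivative, converges to the product of the three. -/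
theorem tendsto_thirdDifference {act : ℝ → ℝ} (hs : ContDiff ℝ ∞ act) {x₀ : ℝ}
    (hx : iteratedDeriv 3 act x₀ ≠ 0) (y : Fin 3 → ℝ) :
    Filter.Tendsto (fun h : ℝ => ∑ s : Fin 2 × Fin 2 × Fin 2,
        act (h * (s.1 * y 0 + s.2.1 * y 1 + s.2.2 * y 2) + x₀) *
          ((-1) ^ ((s.1 : ℕ) + s.2.1 + s.2.2 + 1) / (h ^ 3 * iteratedDeriv 3 act x₀)))
      (nhdsWithin 0 {0}ᶜ) (nhds (y 0 * y 1 * y 2)) := by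
  set c := iteratedDeriv 3 act x₀ with hc
  set P : ℝ → ℝ := fun t => act x₀ + iteratedDeriv 1 act x₀ * t + iteratedDeriv 2 act x₀ / 2 * t ^ 2
    + c / 6 * t ^ 3 with hP
  have h1 : (fun t : ℝ => act (t + x₀) - P t) =o[nhds 0] fun t => t ^ 3 := by
    have := taylor_isLittleO_univ (x₀ := x₀) (n := 3) (hs.of_le (WithTop.coe_le_coe.2 le_top))
    have h2 : Filter.Tendsto (fun t : ℝ => t + x₀) (nhds 0) (nhds x₀) := by
      have : Continuous fun t : ℝ => t + x₀ := by fun_prop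
      simpa using this.tendsto 0
    refine (this.comp_tendsto h2).congr' ?_ ?_
    · refine Filter.Eventually.of_forall fun t => ?_
      simp only [Function.comp, taylorWithinEval_succ, taylor_within_zero_eval, hP,
        iteratedDerivWithin_univ, hc]
      norm_num [Nat.factorial]
      ring
    · refine Filter.Eventually.of_forall fun t => ?_
      simp
  have h3 : ∀ w : ℝ, Filter.Tendsto (fun h : ℝ => (act (h * w + x₀) - P (h * w)) / h ^ 3)
      (nhdsWithin 0 {0}ᶜ) (nhds 0) := by
    intro w
    have hw : Filter.Tendsto (fun h : ℝ => h * w) (nhdsWithin 0 {0}ᶜ) (nhds 0) := by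
      have : Continuous fun h : ℝ => h * w := by fun_prop
      exact (this.tendsto' 0 0 (zero_mul w)).mono_left nhdsWithin_le_nhds
    have h4 := h1.comp_tendsto hw
    have h5 : ((fun t : ℝ => t ^ 3) ∘ fun h : ℝ => h * w) =O[nhdsWithin 0 {0}ᶜ]
        fun h : ℝ => h ^ 3 := by
      refine Asymptotics.IsBigO.of_bound (|w| ^ 3) (Filter.Eventually.of_forall fun h => ?_)
      simp [mul_pow, mul_comm]
    exact (h4.trans_isBigO h5).tendsto_div_nhds_zero
  -- The polynomial part contributes exactly the product, at every nonzero step.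
  have key : ∀ h : ℝ, h ≠ 0 → ∑ s : Fin 2 × Fin 2 × Fin 2,
        act (h * (s.1 * y 0 + s.2.1 * y 1 + s.2.2 * y 2) + x₀) *
          ((-1) ^ ((s.1 : ℕ) + s.2.1 + s.2.2 + 1) / (h ^ 3 * c)) =
      y 0 * y 1 * y 2 + ∑ s : Fin 2 × Fin 2 × Fin 2,
        (act (h * (s.1 * y 0 + s.2.1 * y 1 + s.2.2 * y 2) + x₀) -
          P (h * (s.1 * y 0 + s.2.1 * y 1 + s.2.2 * y 2))) / h ^ 3 *
          ((-1) ^ ((s.1 : ℕ) + s.2.1 + s.2.2 + 1) / c) := by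
    intro h hh
    rw [← sub_eq_iff_eq_add, ← Finset.sum_sub_distrib]
    have : ∀ s : Fin 2 × Fin 2 × Fin 2,
        act (h * (s.1 * y 0 + s.2.1 * y 1 + s.2.2 * y 2) + x₀) *
          ((-1) ^ ((s.1 : ℕ) + s.2.1 + s.2.2 + 1) / (h ^ 3 * c)) -
        (act (h * (s.1 * y 0 + s.2.1 * y 1 + s.2.2 * y 2) + x₀) -
          P (h * (s.1 * y 0 + s.2.1 * y 1 + s.2.2 * y 2))) / h ^ 3 *
          ((-1) ^ ((s.1 : ℕ) + s.2.1 + s.2.2 + 1) / c) =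
        P (h * (s.1 * y 0 + s.2.1 * y 1 + s.2.2 * y 2)) *
          ((-1) ^ ((s.1 : ℕ) + s.2.1 + s.2.2 + 1) / (h ^ 3 * c)) := by
      intro s
      field_simp
      ring
    rw [Finset.sum_congr rfl fun s _ => this s]
    simp only [Fintype.sum_prod_type, Fin.sum_univ_two, hP]
    norm_num
    field_simp
    ring
  have h6 : Filter.Tendsto (fun h : ℝ => y 0 * y 1 * y 2 + ∑ s : Fin 2 × Fin 2 × Fin 2,
        (act (h * (s.1 * y 0 + s.2.1 * y 1 + s.2.2 * y 2) + x₀) -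
          P (h * (s.1 * y 0 + s.2.1 * y 1 + s.2.2 * y 2))) / h ^ 3 *
          ((-1) ^ ((s.1 : ℕ) + s.2.1 + s.2.2 + 1) / c)) (nhdsWithin 0 {0}ᶜ)
      (nhds (y 0 * y 1 * y 2 + ∑ s : Fin 2 × Fin 2 × Fin 2, 0 *
          ((-1) ^ ((s.1 : ℕ) + s.2.1 + s.2.2 + 1) / c))) :=
    tendsto_const_nhds.add (tendsto_finsetSum _ fun s _ => (h3 _).mul_const _)
  simp only [zero_mul, Finset.sum_const_zero, add_zero] at h6
  refine h6.congr' ?_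
  filter_upwards [self_mem_nhdsWithin] with h hh
  exact (key h hh).symm

/-! ### Limits of softmax -/

/-- Softmax is unchanged by a shift `b` of the scores of a row; if the exponentials of the shifted
scores converge to weights that are not all zero, softmax converges to the normalized weights. -/
theorem tendsto_rowSoftmax {ι : Type*} {F : Filter ι} {m : ℕ} {s : ι → Matrix (Fin m) (Fin m) ℝ}
    {i : Fin m} {w : Fin m → ℝ} (b : ι → ℝ)
    (h : ∀ j, Filter.Tendsto (fun a => Real.exp (s a i j - b a)) F (nhds (w j)))
    (hw : ∑ l, w l ≠ 0) (j : Fin m) :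
    Filter.Tendsto (fun a => rowSoftmax (s a) i j) F (nhds (w j / ∑ l, w l)) := by
  have := (h j).div (tendsto_finsetSum Finset.univ fun l _ => h l) hw
  refine this.congr fun a => ?_
  simp only [rowSoftmax, Matrix.of_apply, Real.exp_sub, Pi.div_apply]
  rw [← Finset.sum_div, div_div_div_cancel_right₀ (Real.exp_ne_zero _)]

/-- The indicator of the columns that carry the largest score of row `i`. -/
noncomputable def argmaxWeight {m : ℕ} (M : Matrix (Fin m) (Fin m) ℝ) (i j : Fin m) : ℝ :=
  open Classical in if ∀ l, M i l ≤ M i j then 1 else 0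

/-- Hard attention: the uniform distribution on the columns with the largest score. -/
noncomputable def hardmax {m : ℕ} (M : Matrix (Fin m) (Fin m) ℝ) : Matrix (Fin m) (Fin m) ℝ :=
  Matrix.of fun i j => argmaxWeight M i j / ∑ l, argmaxWeight M i l

theorem tendsto_rowSoftmax_hardmax {m : ℕ} (M : Matrix (Fin m) (Fin m) ℝ) (i j : Fin m) :
    Filter.Tendsto (fun a : ℝ => rowSoftmax (a • M) i j) Filter.atTop (nhds (hardmax M i j)) := by
  have : Nonempty (Fin m) := ⟨i⟩
  obtain ⟨j₀, hj₀⟩ := Finite.exists_max (fun j => M i j)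
  refine tendsto_rowSoftmax (fun a => a * M i j₀) (fun l => ?_) ?_ j
  · by_cases hl : ∀ l', M i l' ≤ M i l
    · have : M i l = M i j₀ := le_antisymm (hj₀ l) (hl j₀)
      rw [show argmaxWeight M i l = 1 from if_pos hl]
      simp only [Matrix.smul_apply, smul_eq_mul, this, sub_self, Real.exp_zero]
      exact tendsto_const_nhds
    · have hlt : M i l - M i j₀ < 0 := by
        push Not at hl
        obtain ⟨l', h'⟩ := hl
        linarith [hj₀ l']
      rw [show argmaxWeight M i l = 0 from if_neg hl]
      simp only [Matrix.smul_apply, smul_eq_mul, ← mul_sub]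
      exact Real.tendsto_exp_atBot.comp (Filter.tendsto_id.atTop_mul_const_of_neg hlt)
  · have h0 : ∀ l, 0 ≤ argmaxWeight M i l := fun l => by unfold argmaxWeight; split <;> simp
    have h1 : argmaxWeight M i j₀ = 1 := if_pos hj₀
    have := Finset.single_le_sum (fun l _ => h0 l) (Finset.mem_univ j₀)
    linarith

theorem hardmax_of_unique {m : ℕ} (M : Matrix (Fin m) (Fin m) ℝ) (i j₀ : Fin m)
    (h : ∀ j, j ≠ j₀ → M i j < M i j₀) (j : Fin m) :
    hardmax M i j = if j = j₀ then 1 else 0 := by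
  have hw : ∀ l, argmaxWeight M i l = if l = j₀ then 1 else 0 := by
    intro l
    unfold argmaxWeight
    by_cases hl : l = j₀
    · subst hl
      rw [if_pos, if_pos rfl]
      intro l'
      rcases eq_or_ne l' l with rfl | hne
      · exact le_rfl
      · exact (h l' hne).le
    · rw [if_neg, if_neg hl]
      intro hc
      exact absurd (h l hl) (not_lt.2 (hc j₀))
  simp [hardmax, hw]

theorem sum_rowSoftmax_pos {m : ℕ} (M : Matrix (Fin m) (Fin m) ℝ) (i : Fin m) :
    0 < ∑ l, Real.exp (M i l) :=
  Finset.sum_pos (fun _ _ => Real.exp_pos _) ⟨i, Finset.mem_univ i⟩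

theorem continuous_rowSoftmax {m : ℕ} : Continuous (rowSoftmax (m := m)) := by
  refine continuous_pi fun i => continuous_pi fun j => ?_
  refine Continuous.div ?_ ?_ fun M => (sum_rowSoftmax_pos M i).ne'
  · exact Real.continuous_exp.comp (continuous_apply_apply i j)
  · exact continuous_finsetSum _ fun l _ => Real.continuous_exp.comp (continuous_apply_apply i l)


/-! ### Limits of layers -/

theorem continuous_attn {d k h w m : ℕ} (Λ : TLayer d k h w) :
    Continuous (Λ.attn : Matrix (Fin m) (Fin d) ℝ → Matrix (Fin m) (Fin d) ℝ) := by
  have h1 : ∀ q : Fin h, Continuous fun X : Matrix (Fin m) (Fin d) ℝ => (Λ.heads q).apply X := by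
    intro q
    unfold AttnHead.apply
    refine Continuous.matrix_mul (Continuous.matrix_mul (continuous_rowSoftmax.comp ?_)
      continuous_id) continuous_const
    fun_prop
  refine Continuous.matrix_mul ?_ continuous_const
  exact continuous_pi fun i => continuous_pi fun c => (continuous_apply_apply i c.2).comp (h1 c.1)

theorem continuous_mlp {d k h w m : ℕ} {act : ℝ → ℝ} (ha : Continuous act) (Λ : TLayer d k h w) :
    Continuous (Λ.mlp act : Matrix (Fin m) (Fin d) ℝ → Matrix (Fin m) (Fin d) ℝ) := by
  refine continuous_pi fun i => continuous_pi fun c => ?_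
  simp only [TLayer.mlp, Matrix.of_apply]
  fun_prop

theorem continuous_layer {d k h w m : ℕ} {act : ℝ → ℝ} (ha : Continuous act)
    (Λ : TLayer d k h w) :
    Continuous (Λ.apply act : Matrix (Fin m) (Fin d) ℝ → Matrix (Fin m) (Fin d) ℝ) :=
  (continuous_mlp ha Λ).comp (continuous_attn Λ)

/-- Apply a list of layers, first to last. -/
noncomputable def runLayers {d k h w m : ℕ} (act : ℝ → ℝ) (Ls : List (TLayer d k h w))
    (X : Matrix (Fin m) (Fin d) ℝ) : Matrix (Fin m) (Fin d) ℝ :=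
  Ls.foldl (fun X Λ => Λ.apply act X) X

theorem continuous_runLayers {d k h w m : ℕ} {act : ℝ → ℝ} (ha : Continuous act)
    (Ls : List (TLayer d k h w)) :
    Continuous (runLayers act Ls : Matrix (Fin m) (Fin d) ℝ → Matrix (Fin m) (Fin d) ℝ) := by
  induction Ls with
  | nil => exact continuous_id
  | cons Λ Ls ih => exact ih.comp (continuous_layer ha Λ)

/-- The embeddings of all strings of the family `I` that `L` layers can produce from `X`. -/
def reachable {I : Type*} {len : I → ℕ} {d : ℕ} (k h w : ℕ) (act : ℝ → ℝ) (L : ℕ)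
    (X : (t : I) → Matrix (Fin (len t)) (Fin d) ℝ) :
    Set ((t : I) → Matrix (Fin (len t)) (Fin d) ℝ) :=
  {Y | ∃ Ls : List (TLayer d k h w), Ls.length = L ∧ Y = fun t => runLayers act Ls (X t)}

/-- Limits of layers compose: since layers are continuous, running `L'` layers on a limit of outputs
of `L` layers gives a limit of outputs of `L + L'` layers. -/
theorem closure_reachable_trans {I : Type*} {len : I → ℕ} {d k h w : ℕ} {act : ℝ → ℝ}
    (ha : Continuous act) {L L' : ℕ} {X Y Z : (t : I) → Matrix (Fin (len t)) (Fin d) ℝ}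
    (hY : Y ∈ closure (reachable k h w act L X)) (hZ : Z ∈ closure (reachable k h w act L' Y)) :
    Z ∈ closure (reachable k h w act (L + L') X) := by
  refine closure_minimal ?_ isClosed_closure hZ
  rintro _ ⟨Ls', hLs', rfl⟩
  have hc : Continuous fun (Y : (t : I) → Matrix (Fin (len t)) (Fin d) ℝ) t =>
      runLayers act Ls' (Y t) :=
    continuous_pi fun t => (continuous_runLayers ha Ls').comp (continuous_apply t)
  refine closure_mono ?_ (image_closure_subset_closure_image hc ⟨Y, hY, rfl⟩)
  rintro _ ⟨_, ⟨Ls, hLs, rfl⟩, rfl⟩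
  refine ⟨Ls ++ Ls', by simp [hLs, hLs'], ?_⟩
  funext t
  simp [runLayers]

/-- Attention with weights `a q` for head `q`, in which coordinate `c` of the output is read from
coordinate `src c` by the head `hd c`. -/
def routedAttn {d h m : ℕ} (a : Fin h → Matrix (Fin m) (Fin m) ℝ) (hd : Fin d → Fin h)
    (src : Fin d → Fin d) (X : Matrix (Fin m) (Fin d) ℝ) : Matrix (Fin m) (Fin d) ℝ :=
  Matrix.of fun i c => ∑ j, a (hd c) i j * X j (src c)

/-- In each row, the linear combinations with coefficients `V` of the products of three coordinates
`f u 0`, `f u 1`, `f u 2`. -/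
def tripleProducts {U : Type*} [Fintype U] {d m : ℕ} (f : U → Fin 3 → Fin d) (V : U → Fin d → ℝ)
    (X : Matrix (Fin m) (Fin d) ℝ) : Matrix (Fin m) (Fin d) ℝ :=
  Matrix.of fun i c => ∑ u, X i (f u 0) * X i (f u 1) * X i (f u 2) * V u c

/-- The eight neurons spent on each triple product, numbered. -/
noncomputable def neuronEquiv (U : Type*) [Fintype U] :
    Fin (8 * Fintype.card U) ≃ U × Fin 2 × Fin 2 × Fin 2 :=
  (Fintype.equivFinOfCardEq (by simp; ring)).symm

/-- A layer whose heads have the bilinear scores `W q` and whose attention output is routed by `hd`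
and `src`, followed by the third differences of step `r` at `x₀` that approximate
`tripleProducts f V`; here `c₃` stands for the third derivative of the activation at `x₀`. -/
noncomputable def differenceLayer {U : Type*} [Fintype U] {d h : ℕ}
    (W : Fin h → Matrix (Fin d) (Fin d) ℝ) (hd : Fin d → Fin h) (src : Fin d → Fin d)
    (f : U → Fin 3 → Fin d) (V : U → Fin d → ℝ) (x₀ c₃ r : ℝ) :
    TLayer d d h (8 * Fintype.card U) where
  heads q := ⟨W q, 1, 1⟩
  WO := Matrix.of fun p c => if p.1 = hd c ∧ p.2 = src c then 1 else 0
  W₁ := Matrix.of fun c v =>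
    let s := neuronEquiv U v
    r * ((s.2.1 : ℕ) * (if c = f s.1 0 then 1 else 0) +
      (s.2.2.1 : ℕ) * (if c = f s.1 1 then 1 else 0) + (s.2.2.2 : ℕ) * (if c = f s.1 2 then 1 else 0))
  b₁ _ := x₀
  W₂ := Matrix.of fun v c =>
    let s := neuronEquiv U v
    (-1) ^ ((s.2.1 : ℕ) + s.2.2.1 + s.2.2.2 + 1) / (r ^ 3 * c₃) * V s.1 c
  b₂ _ := 0

section

variable {U : Type*} [Fintype U] {d h m : ℕ} (W : Fin h → Matrix (Fin d) (Fin d) ℝ)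
  (hd : Fin d → Fin h) (src : Fin d → Fin d) (f : U → Fin 3 → Fin d) (V : U → Fin d → ℝ)
  (x₀ c₃ r : ℝ) (X : Matrix (Fin m) (Fin d) ℝ)

theorem differenceLayer_attn : (differenceLayer W hd src f V x₀ c₃ r).attn X =
    routedAttn (fun q => rowSoftmax (X * W q * X.transpose)) hd src X := by
  ext i c
  simp only [TLayer.attn, differenceLayer, AttnHead.apply, routedAttn, Matrix.transpose_one,
    Matrix.mul_one, Matrix.of_apply]
  rw [Matrix.mul_apply, Finset.sum_eq_single (hd c, src c)]
  · simp [Matrix.mul_apply]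
  · rintro ⟨q, a⟩ _ hne
    rw [Matrix.of_apply, Matrix.of_apply, if_neg (by simpa using hne), mul_zero]
  · simp

theorem differenceLayer_mlp (act : ℝ → ℝ) (i : Fin m) (c : Fin d) :
    (differenceLayer W hd src f V x₀ c₃ r).mlp act X i c =
      ∑ u, (∑ s : Fin 2 × Fin 2 × Fin 2,
        act (r * (s.1 * X i (f u 0) + s.2.1 * X i (f u 1) + s.2.2 * X i (f u 2)) + x₀) *
          ((-1) ^ ((s.1 : ℕ) + s.2.1 + s.2.2 + 1) / (r ^ 3 * c₃))) * V u c := by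
  simp only [TLayer.mlp, differenceLayer, Matrix.of_apply, add_zero, Finset.sum_mul]
  rw [← Fintype.sum_prod_type', ← Equiv.sum_comp (neuronEquiv U)]
  refine Finset.sum_congr rfl fun v _ => ?_
  rw [← mul_assoc]
  congr 4
  have : ∀ e, ∑ a, X i a * (if a = e then (1 : ℝ) else 0) = X i e := fun e => by simp
  simp only [← this (f _ _), Finset.mul_sum, ← Finset.sum_add_distrib]
  refine Finset.sum_congr rfl fun a _ => ?_
  ring

end

/-- The limits of a single layer: attention with limits of softmax weights, followed by linear
combinations of triple products. -/
theorem tripleProducts_routedAttn_mem_closure {I : Type*} {len : I → ℕ} {d h : ℕ} {act : ℝ → ℝ}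
    (hs : ContDiff ℝ ∞ act) {x₀ : ℝ} (hx : iteratedDeriv 3 act x₀ ≠ 0)
    {U : Type*} [Fintype U] (X : (t : I) → Matrix (Fin (len t)) (Fin d) ℝ)
    (W : ℝ → Fin h → Matrix (Fin d) (Fin d) ℝ)
    (a : (t : I) → Fin h → Matrix (Fin (len t)) (Fin (len t)) ℝ)
    (ha : ∀ t q i j, Filter.Tendsto
      (fun l => rowSoftmax (X t * W l q * (X t).transpose) i j) Filter.atTop (nhds (a t q i j)))
    (hd : Fin d → Fin h) (src : Fin d → Fin d) (f : U → Fin 3 → Fin d) (V : U → Fin d → ℝ) :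
    (fun t => tripleProducts f V (routedAttn (a t) hd src (X t))) ∈
      closure (reachable d h (8 * Fintype.card U) act 1 X) := by
  have step : ∀ r : ℝ, (fun t => (differenceLayer (W 0) hd src f V x₀
      (iteratedDeriv 3 act x₀) r).mlp act (routedAttn (a t) hd src (X t))) ∈
      closure (reachable d h (8 * Fintype.card U) act 1 X) := by
    intro r
    refine mem_closure_of_tendsto (b := Filter.atTop) (f := fun l t => (differenceLayer (W l) hd
      src f V x₀ (iteratedDeriv 3 act x₀) r).apply act (X t)) ?_
      (Filter.Eventually.of_forall fun l => ⟨[_], rfl, rfl⟩)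
    refine tendsto_pi_nhds.2 fun t => ?_
    have h1 : Filter.Tendsto (fun l => (differenceLayer (W l) hd src f V x₀
        (iteratedDeriv 3 act x₀) r).attn (X t)) Filter.atTop
        (nhds (routedAttn (a t) hd src (X t))) := by
      simp only [differenceLayer_attn]
      refine tendsto_pi_nhds.2 fun i => tendsto_pi_nhds.2 fun c => ?_
      simp only [routedAttn, Matrix.of_apply]
      exact tendsto_finsetSum _ fun j _ => (ha t (hd c) i j).mul_const _
    exact ((continuous_mlp hs.continuous (differenceLayer (W 0) hd src f V x₀
      (iteratedDeriv 3 act x₀) r)).tendsto _).comp h1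
  rw [← closure_closure]
  refine mem_closure_of_tendsto (b := nhdsWithin (0 : ℝ) {0}ᶜ) ?_
    (Filter.Eventually.of_forall step)
  refine tendsto_pi_nhds.2 fun t => tendsto_pi_nhds.2 fun i => tendsto_pi_nhds.2 fun c => ?_
  simp only [differenceLayer_mlp, tripleProducts, Matrix.of_apply]
  exact tendsto_finsetSum _ fun u _ =>
    (tendsto_thirdDifference hs hx fun e => routedAttn (a t) hd src (X t) i (f u e)).mul_const _


/-! ### Heights and subtrees in bracket representations -/

/-- Contribution of a symbol to the nesting depth of the positions to its right. -/
def BSym.weight {S : Type*} : BSym S → ℤ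
  | .letter _ => 0
  | .opening => 1
  | .closing => -1

/-- Number of brackets that are open before position `i`. -/
def height {S : Type*} (x : List (BSym S)) (i : ℕ) : ℤ := ((x.take i).map BSym.weight).sum

section

variable {S : Type*}

theorem height_add (x : List (BSym S)) (i k : ℕ) :
    height x (i + k) = height x i + height (x.drop i) k := by
  simp [height, List.take_add]

theorem height_append_of_le {x y : List (BSym S)} {k : ℕ} (h : k ≤ x.length) :
    height (x ++ y) k = height x k := by
  simp [height, List.take_append_of_le_length h]

theorem height_cons_succ (a : BSym S) (x : List (BSym S)) (k : ℕ) :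
    height (a :: x) (k + 1) = a.weight + height x k := by
  simp [height]

theorem height_append_add (x y : List (BSym S)) (k : ℕ) :
    height (x ++ y) (x.length + k) = height x x.length + height y k := by
  rw [height_add, height_append_of_le le_rfl, List.drop_left]

theorem height_str_length (t : LTree S) : height t.str t.str.length = 0 := by
  induction t with
  | leaf a => simp [height, LTree.str, BSym.weight]
  | node l r ihl ihr =>
    simp only [height, List.take_length] at ihl ihr ⊢
    simp [LTree.str, BSym.weight, ihl, ihr]

theorem height_str_nonneg (t : LTree S) (k : ℕ) (hk : k ≤ t.str.length) : 0 ≤ height t.str k := by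
  induction t generalizing k with
  | leaf a =>
    rcases Nat.le_one_iff_eq_zero_or_eq_one.1 (by simpa [LTree.str] using hk) with rfl | rfl <;>
      simp [height, LTree.str, BSym.weight]
  | node l r ihl ihr =>
    rcases hk.eq_or_lt with rfl | hk
    · exact (height_str_length _).ge
    cases k with
    | zero => simp [height]
    | succ k =>
      simp only [LTree.str, List.length_cons, List.length_append, List.length_nil] at hk
      rw [LTree.str, height_cons_succ, BSym.weight]
      rcases le_total k l.str.length with h | h
      · rw [height_append_of_le h]
        linarith [ihl k h]
      · obtain ⟨e, rfl⟩ := Nat.exists_eq_add_of_le h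
        rw [height_append_add, height_str_length, height_append_of_le (by omega)]
        linarith [ihr e (by omega)]

/-- A proper nonempty prefix of the representation of a tree leaves a bracket open. -/
theorem height_str_pos (t : LTree S) (k : ℕ) (h0 : 0 < k) (hk : k < t.str.length) :
    0 < height t.str k := by
  cases t with
  | leaf a =>
    simp only [LTree.str, List.length_cons, List.length_nil] at hk
    omega
  | node l r =>
    obtain ⟨k, rfl⟩ := Nat.exists_eq_succ_of_ne_zero h0.ne'
    simp only [LTree.str, List.length_cons, List.length_append, List.length_nil] at hk
    rw [LTree.str, height_cons_succ, BSym.weight]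
    rcases le_total k l.str.length with h | h
    · rw [height_append_of_le h]
      linarith [height_str_nonneg l k h]
    · obtain ⟨e, rfl⟩ := Nat.exists_eq_add_of_le h
      rw [height_append_add, height_str_length, height_append_of_le (by omega)]
      linarith [height_str_nonneg r e (by omega)]

theorem str_length_pos (t : LTree S) : 0 < t.str.length := by
  cases t <;> simp [LTree.str]

/-- The right child of the node represented at position `i` starts at the first position `j > i + 1`
whose height exceeds that of `i` by one. -/
theorem exists_rightChild {x : List (BSym S)} {i : ℕ} {l r : LTree S}
    (h : (LTree.node l r).str <+: x.drop i) :
    l.str <+: x.drop (i + 1) ∧ ∃ j, i + 1 < j ∧ j < x.length ∧ r.str <+: x.drop j ∧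
      height x j = height x i + 1 ∧ ∀ j', i + 1 < j' → j' < j → height x j' ≠ height x i + 1 := by
  obtain ⟨v, hv⟩ := h
  have h1 : x.drop (i + 1) = l.str ++ (r.str ++ [BSym.closing] ++ v) := by
    rw [← List.drop_drop, ← hv]
    simp [LTree.str]
  have hop : height x (i + 1) = height x i + 1 := by
    rw [height_add, ← hv]
    simp [LTree.str, height, BSym.weight]
  have h2 : x.drop (i + 1 + l.str.length) = r.str ++ ([BSym.closing] ++ v) := by
    rw [← List.drop_drop, h1]
    simp
  refine ⟨⟨_, h1.symm⟩, i + 1 + l.str.length, ?_, ?_, ⟨_, h2.symm⟩, ?_, ?_⟩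
  · have := str_length_pos l
    omega
  · have := congrArg List.length h2
    simp only [List.length_drop, List.length_append, List.length_cons] at this
    omega
  · rw [height_add, h1, height_append_of_le le_rfl, height_str_length, hop, add_zero]
  · intro j' hj1 hj2
    obtain ⟨e, rfl⟩ := Nat.exists_eq_add_of_le hj1.le
    rw [height_add, h1, height_append_of_le (by omega), hop]
    have := height_str_pos l e (by omega) (by omega)
    omega

theorem height_eq_sum (x : List (BSym S)) (i : ℕ) (hi : i ≤ x.length) :
    height x i = ∑ j : Fin x.length, if (j : ℕ) < i then (x.get j).weight else 0 := by
  induction i with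
  | zero => simp [height]
  | succ i ih =>
    have h1 : height x (i + 1) = height x i + (x.get ⟨i, hi⟩).weight := by
      rw [height, List.take_succ_eq_append_getElem hi, List.map_append, List.sum_append]
      simp only [height, List.map_cons, List.map_nil, List.sum_singleton, List.get_eq_getElem]
    rw [h1, ih (by omega),
      ← Fintype.sum_ite_eq' (⟨i, hi⟩ : Fin x.length) fun j => (x.get j).weight,
      ← Finset.sum_add_distrib]
    refine Finset.sum_congr rfl fun j _ => ?_
    have : j = ⟨i, hi⟩ ↔ (j : ℕ) = i := Fin.ext_iff
    simp only [this]
    split_ifs <;> grind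

end

/-! ### States of the automaton truncated at a given depth -/

namespace WTA

variable {S : Type*} {n : ℕ} (A : WTA S n)

/-- The state of the automaton on a tree when the inner nodes `k` levels below the root are given
the state `0`. -/
def truncMu : ℕ → LTree S → Fin n → ℝ
  | _, .leaf a => A.init a
  | 0, .node _ _ => 0
  | k + 1, .node l r => fun q => ∑ i, ∑ j, A.trans q i j * truncMu k l i * truncMu k r j

theorem truncMu_eq_mu (t : LTree S) (k : ℕ) (h : t.depth ≤ k) : A.truncMu k t = A.mu t := by
  induction t generalizing k with
  | leaf a => cases k <;> rfl
  | node l r ihl ihr =>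
    cases k with
    | zero => simp [LTree.depth] at h
    | succ k =>
      simp only [LTree.depth, Nat.add_le_add_iff_right, max_le_iff] at h
      simp only [truncMu, mu, ihl k h.1, ihr k h.2]

/-- The vector of a letter; `0` for the brackets. -/
def symVec : BSym S → Fin n → ℝ
  | .letter a => A.init a
  | .opening => 0
  | .closing => 0

/-- The state, truncated at depth `k`, of the tree represented by a substring starting at position
`i`; it is `0` if there is none. -/
noncomputable def stateAt (k : ℕ) (x : List (BSym S)) (i : ℕ) : Fin n → ℝ :=
  open Classical in if h : ∃ s : LTree S, s.str <+: x.drop i then A.truncMu k h.choose else 0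

theorem stateAt_eq {k : ℕ} {x : List (BSym S)} {i : ℕ} {s : LTree S} (h : s.str <+: x.drop i) :
    A.stateAt k x i = A.truncMu k s := by
  have hex : ∃ s : LTree S, s.str <+: x.drop i := ⟨s, h⟩
  rw [stateAt, dif_pos hex]
  obtain ⟨u, hu⟩ := h
  obtain ⟨u', hu'⟩ := hex.choose_spec
  rw [(LTree.str_append_inj _ _ _ _ (hu'.trans hu.symm)).1]

theorem stateAt_of_ne_opening (k : ℕ) {x : List (BSym S)} (i : Fin x.length)
    (h : x.get i ≠ .opening) : A.stateAt k x i = A.symVec (x.get i) := by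
  by_cases hex : ∃ s : LTree S, s.str <+: x.drop i
  · obtain ⟨s, hs⟩ := hex
    rw [A.stateAt_eq hs]
    obtain ⟨u, hu⟩ := hs
    rw [List.drop_eq_getElem_cons i.2] at hu
    cases s with
    | leaf a =>
      simp only [LTree.str, List.cons_append, List.cons.injEq] at hu
      rw [List.get_eq_getElem, ← hu.1]
      cases k <;> rfl
    | node l r =>
      simp only [LTree.str, List.cons_append, List.cons.injEq] at hu
      exact absurd hu.1.symm h
  · rw [stateAt, dif_neg hex]
    cases hx : x.get i with
    | letter a =>
      refine absurd ⟨LTree.leaf a, ?_⟩ hex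
      rw [List.drop_eq_getElem_cons i.2]
      rw [List.get_eq_getElem] at hx
      simp [LTree.str, hx]
    | opening => rfl
    | closing => rfl

/-- At an opening bracket of a representation, the truncated state is obtained from those at the
next position and at the first later position that is one level deeper. -/
theorem stateAt_of_opening (t : LTree S) (i : Fin t.str.length) (h : t.str.get i = .opening) :
    A.stateAt 0 t.str i = 0 ∧ ∃ j : Fin t.str.length, (i : ℕ) + 1 < j ∧
      height t.str j = height t.str i + 1 ∧
      (∀ j', (i : ℕ) + 1 < j' → j' < j → height t.str j' ≠ height t.str i + 1) ∧
      ∀ k q, A.stateAt (k + 1) t.str i q =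
        ∑ a, ∑ b, A.trans q a b * A.stateAt k t.str (i + 1) a * A.stateAt k t.str j b := by
  obtain ⟨s, hs⟩ := LTree.exists_str_prefix t i i.2 (by rw [h]; rfl)
  have hs' := hs
  obtain ⟨u, hu⟩ := hs'
  rw [List.drop_eq_getElem_cons i.2] at hu
  cases s with
  | leaf a =>
    simp only [LTree.str, List.cons_append, List.cons.injEq] at hu
    rw [List.get_eq_getElem, ← hu.1] at h
    cases h
  | node l r =>
    obtain ⟨hl, j, h1, h2, hr, h3, h4⟩ := exists_rightChild hs
    refine ⟨by rw [A.stateAt_eq hs]; rfl, ⟨j, h2⟩, h1, h3, h4, fun k q => ?_⟩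
    rw [A.stateAt_eq hs, A.stateAt_eq hl, A.stateAt_eq hr]
    rfl

end WTA

/-- A tree represented by a substring is a subtree, hence not deeper than the whole tree. -/
theorem LTree.depth_le_of_prefix {S : Type*} (t : LTree S) :
    ∀ (i : ℕ) (s : LTree S), i < t.str.length → s.str <+: t.str.drop i → s.depth ≤ t.depth := by
  induction t with
  | leaf a =>
    intro i s hi hs
    obtain rfl : i = 0 := by simpa [str] using hi
    obtain ⟨u, hu⟩ := hs
    rw [List.drop_zero, ← List.append_nil (leaf a).str] at hu
    rw [(str_append_inj _ _ _ _ hu).1]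
  | node l r ihl ihr =>
    intro i s hi ⟨u, hu⟩
    cases i with
    | zero =>
      rw [List.drop_zero, ← List.append_nil (node l r).str] at hu
      rw [(str_append_inj _ _ _ _ hu).1]
    | succ i =>
      simp only [str, List.length_cons, List.length_append, List.length_nil] at hi
      simp only [str, List.drop_succ_cons] at hu
      -- A representation that starts inside one of the children stays inside it.
      have key : ∀ (c : LTree S) (v : List (BSym S)) (e : ℕ), e < c.str.length →
          (∀ (i : ℕ) (s : LTree S), i < c.str.length → s.str <+: c.str.drop i →
            s.depth ≤ c.depth) → s.str ++ u = c.str.drop e ++ v → s.depth ≤ c.depth := by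
        intro c v e he ih hs
        by_cases hc : (c.str.get ⟨e, he⟩).isClosing = false
        · obtain ⟨s', u', hs'⟩ := exists_str_prefix c e he hc
          rw [← hs', List.append_assoc] at hs
          rw [(str_append_inj _ _ _ _ hs).1]
          exact ih e s' he ⟨u', hs'⟩
        · rw [List.drop_eq_getElem_cons he] at hs
          cases s with
          | leaf a =>
            simp only [str, List.cons_append, List.cons.injEq] at hs
            rw [List.get_eq_getElem, ← hs.1] at hc
            exact absurd rfl hc
          | node _ _ =>
            simp only [str, List.cons_append, List.cons.injEq] at hs
            rw [List.get_eq_getElem, ← hs.1] at hc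
            exact absurd rfl hc
      simp only [depth]
      rcases lt_or_ge i l.str.length with h | h
      · rw [List.drop_append_of_le_length h.le] at hu
        exact (key l _ i h ihl hu).trans ((le_max_left _ _).trans (Nat.le_succ _))
      · obtain ⟨e, rfl⟩ := Nat.exists_eq_add_of_le h
        rw [← List.drop_drop, List.drop_left] at hu
        rcases lt_or_ge e r.str.length with h' | h'
        · rw [List.drop_append_of_le_length h'.le] at hu
          exact (key r _ e h' ihr hu).trans ((le_max_right _ _).trans (Nat.le_succ _))
        · obtain rfl : e = r.str.length := by omega
          rw [List.drop_left] at hu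
          cases s <;> simp [str] at hu

theorem LTree.depth_lt_length {S : Type*} (t : LTree S) : t.depth < t.str.length := by
  induction t with
  | leaf a => simp [depth, str]
  | node l r ihl ihr => simp only [depth, str, List.length_cons, List.length_append]; omega

theorem LTree.str_injective {S : Type*} : Function.Injective (LTree.str (S := S)) :=
  fun s t h => (LTree.str_append_inj s t [] [] (by simpa using h)).1

instance BSym.finite {S : Type*} [Finite S] : Finite (BSym S) := by
  refine Finite.of_injective (β := Option (Option S)) (fun
    | .letter a => some (some a)
    | .opening => none
    | .closing => some none) ?_
  rintro (_ | _ | _) (_ | _ | _) h <;> simp_all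

theorem LTree.finite_length_le {S : Type*} [Finite S] (T : ℕ) :
    Finite {t : LTree S // t.str.length ≤ T} := by
  have := (List.finite_length_le (BSym S) T).to_subtype
  exact Finite.of_injective (β := {x : List (BSym S) | x.length ≤ T})
    (fun t => ⟨t.1.str, t.2⟩) fun s t h => Subtype.ext (str_injective (congrArg Subtype.val h))


/-! ### Positional scores -/

/-- With base `N` large, nearly `0` if `j < i` and hugely negative otherwise. For fixed `N` it is a
product of a function of `i` and a function of `j`. -/
noncomputable def maskScore (N : ℝ) (i j : ℕ) : ℝ :=
  -(N⁻¹ * (N ^ 2 * (N ^ 2) ^ j * ((N ^ 2) ^ i)⁻¹))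

/-- Attention weights of the mask; for `i > 0` row `i` is close to uniform on the columns
before `i`. -/
noncomputable def maskWeight (N : ℝ) (m : ℕ) : Matrix (Fin m) (Fin m) ℝ :=
  rowSoftmax (Matrix.of fun i j => maskScore N i j)

theorem tendsto_exp_maskScore (i j : ℕ) :
    Filter.Tendsto (fun N => Real.exp (maskScore N i j)) Filter.atTop
      (nhds (if j < i then 1 else 0)) := by
  split_ifs with h
  · rw [← Real.exp_zero]
    refine (Real.continuous_exp.tendsto 0).comp ?_
    obtain ⟨e, rfl⟩ := Nat.exists_eq_add_of_lt h
    refine squeeze_zero_norm' ?_ tendsto_inv_atTop_zero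
    filter_upwards [Filter.eventually_ge_atTop 1] with N hN
    have hN0 : 0 < N := by linarith
    have h1 : N ^ 2 * (N ^ 2) ^ j * ((N ^ 2) ^ (j + e + 1))⁻¹ = ((N ^ 2) ^ e)⁻¹ := by
      field_simp
      ring
    have h2 : ((N ^ 2) ^ e)⁻¹ ≤ 1 := inv_le_one_of_one_le₀ (one_le_pow₀ (one_le_pow₀ hN))
    rw [maskScore, h1, norm_neg, Real.norm_of_nonneg (by positivity)]
    exact mul_le_of_le_one_right (by positivity) h2
  · refine Real.tendsto_exp_atBot.comp ?_
    obtain ⟨e, rfl⟩ := Nat.exists_eq_add_of_le (not_lt.1 h)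
    refine Filter.tendsto_atBot_mono' _ ?_ Filter.tendsto_neg_atTop_atBot
    filter_upwards [Filter.eventually_ge_atTop 1] with N hN
    have hN0 : 0 < N := by linarith
    have h1 : N⁻¹ * (N ^ 2 * (N ^ 2) ^ (i + e) * ((N ^ 2) ^ i)⁻¹) = N * (N ^ 2) ^ e := by
      field_simp
      ring
    have h2 : 1 ≤ (N ^ 2) ^ e := one_le_pow₀ (one_le_pow₀ hN)
    rw [maskScore, h1]
    nlinarith

theorem tendsto_mul_maskWeight {m : ℕ} (i j : Fin m) :
    Filter.Tendsto (fun N => (i : ℝ) * maskWeight N m i j) Filter.atTop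
      (nhds (if j < i then 1 else 0)) := by
  rcases Nat.eq_zero_or_pos (i : ℕ) with hi | hi
  · have : ¬ j < i := by rw [Fin.lt_def]; omega
    simp [hi, this]
  · have hsum : ∑ l : Fin m, (if (l : ℕ) < i then (1 : ℝ) else 0) = i := by
      rw [Finset.sum_boole]
      have : (Finset.univ.filter fun l : Fin m => (l : ℕ) < i) = Finset.Iio i := by
        ext l; simp
      rw [this, Fin.card_Iio]
    have := (tendsto_rowSoftmax (F := Filter.atTop)
      (s := fun N => (Matrix.of fun i j : Fin m => maskScore N i j)) (i := i)
      (w := fun l => if (l : ℕ) < i then 1 else 0) (fun _ => 0)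
      (fun l => by simpa using tendsto_exp_maskScore i l)
      (by rw [hsum]; exact_mod_cast hi.ne') j).const_mul (i : ℝ)
    rw [hsum, mul_div_cancel₀ _ (by exact_mod_cast hi.ne')] at this
    exact this

/-- A base for the mask that is large enough for all strings of length at most `T`. -/
theorem exists_maskBase (T : ℕ) : ∃ N : ℝ, 4 ≤ N ∧ (T + 1 : ℝ) < N ∧ ∀ m ≤ T, ∀ i j : Fin m,
    |(i : ℝ) * maskWeight N m i j - if j < i then 1 else 0| ≤ 1 / (8 * (T + 1) ^ 2) := by
  have h1 : ∀ᶠ N : ℝ in Filter.atTop, ∀ m : Fin (T + 1), ∀ i j : Fin m,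
      |(i : ℝ) * maskWeight N m i j - if j < i then 1 else 0| ≤ 1 / (8 * (T + 1) ^ 2) := by
    refine Filter.eventually_all.2 fun m => Filter.eventually_all.2 fun i =>
      Filter.eventually_all.2 fun j => ?_
    have h2 := tendsto_mul_maskWeight i j
    have hpos : (0 : ℝ) < 1 / (8 * (T + 1) ^ 2) := by positivity
    filter_upwards [h2.eventually (Metric.closedBall_mem_nhds _ hpos)] with N hN
    exact hN
  obtain ⟨N, h, h4, hT⟩ := (h1.and ((Filter.eventually_ge_atTop 4).and
    (Filter.eventually_gt_atTop (T + 1 : ℝ)))).exists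
  exact ⟨N, h4, hT, fun m hm i j => h ⟨m, by omega⟩ i j⟩

/-- The estimate of the heights that the mask gives: the mean weight of the symbols before position
`i`, multiplied by `i`. At `i = 0` the mask has no column to select, but the factor `i` makes the
estimate exact. -/
noncomputable def approxHeight {S : Type*} (N : ℝ) (x : List (BSym S)) (i : Fin x.length) : ℝ :=
  i * ∑ j, maskWeight N x.length i j * (x.get j).weight

theorem abs_approxHeight_sub_le {S : Type*} {N : ℝ} {T : ℕ} (x : List (BSym S))
    (hx : x.length ≤ T)
    (hN : ∀ m ≤ T, ∀ i j : Fin m,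
      |(i : ℝ) * maskWeight N m i j - if j < i then 1 else 0| ≤ 1 / (8 * (T + 1) ^ 2))
    (i : Fin x.length) : |approxHeight N x i - height x i| ≤ 1 / (8 * (T + 1)) := by
  have hw : ∀ a : BSym S, |((a.weight : ℤ) : ℝ)| ≤ 1 := by
    rintro (_ | _ | _) <;> simp [BSym.weight]
  have h1 : approxHeight N x i - height x i = ∑ j : Fin x.length,
      ((i : ℝ) * maskWeight N x.length i j - if j < i then 1 else 0) * (x.get j).weight := by
    rw [approxHeight, height_eq_sum x i i.2.le, Finset.mul_sum, Int.cast_sum,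
      ← Finset.sum_sub_distrib]
    refine Finset.sum_congr rfl fun j _ => ?_
    by_cases h : j < i
    · rw [if_pos h, if_pos (Fin.lt_def.1 h)]
      ring
    · rw [if_neg h, if_neg (mt Fin.lt_def.2 h), Int.cast_zero]
      ring
  rw [h1]
  calc _ ≤ ∑ j : Fin x.length, 1 / (8 * (T + 1 : ℝ) ^ 2) := by
        refine (Finset.abs_sum_le_sum_abs _ _).trans (Finset.sum_le_sum fun j _ => ?_)
        rw [abs_mul]
        exact (mul_le_of_le_one_right (abs_nonneg _) (hw _)).trans (hN _ hx i j)
    _ = x.length * (1 / (8 * (T + 1 : ℝ) ^ 2)) := by simp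
    _ ≤ (T + 1) * (1 / (8 * (T + 1 : ℝ) ^ 2)) := by
        gcongr
        exact_mod_cast hx.trans (Nat.le_succ T)
    _ = 1 / (8 * (T + 1)) := by field_simp

/-- The score by which a node at position `i` finds its right child: it penalizes, in decreasing
order of severity, positions up to `i + 1`, heights other than one more than that of `i`, and large
positions. -/
noncomputable def rightScore (T : ℕ) (N : ℝ) (i j : ℕ) (hi hj : ℝ) : ℝ :=
  -(4 * (T + 1) * (hj - hi - 1) ^ 2) - N * (N ^ 2 * (N ^ 2) ^ i * ((N ^ 2) ^ j)⁻¹) - j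

theorem rightScore_lt {T m : ℕ} {N : ℝ} (h4 : 4 ≤ N) (hT : (T + 1 : ℝ) < N) (hm : m ≤ T)
    {H : ℕ → ℤ} {h : Fin m → ℝ} (hh : ∀ i, |h i - H i| ≤ 1 / (8 * (T + 1))) {i j : Fin m}
    (hij : (i : ℕ) + 1 < j) (hHj : H j = H i + 1)
    (hmin : ∀ j' : ℕ, (i : ℕ) + 1 < j' → j' < j → H j' ≠ H i + 1) (j' : Fin m) (hne : j' ≠ j) :
    rightScore T N i j' (h i) (h j') < rightScore T N i j (h i) (h j) := by
  have hN0 : 0 < N := by linarith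
  have hT0 : (0 : ℝ) < T + 1 := by positivity
  have hN1 : 1 ≤ N ^ 2 := one_le_pow₀ (by linarith)
  have hjT : (j : ℝ) + 1 ≤ T := by exact_mod_cast (Nat.succ_le_of_lt j.2).trans hm
  have hδ : (1 : ℝ) / (8 * (T + 1)) ≤ 1 / 8 := by
    refine one_div_le_one_div_of_le (by norm_num) ?_
    have : (0 : ℝ) ≤ T := by positivity
    linarith
  -- The score of the right child exceeds `-(j + 1)`.
  have hj : -(j + 1 : ℝ) < rightScore T N i j (h i) (h j) := by
    have e1 : |h j - h i - 1| ≤ 1 / (4 * (T + 1)) := by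
      have hc : (H j : ℝ) = H i + 1 := by exact_mod_cast hHj
      have : h j - h i - 1 = (h j - H j) - (h i - H i) := by rw [hc]; ring
      rw [this]
      refine (abs_sub _ _).trans ((add_le_add (hh j) (hh i)).trans (le_of_eq ?_))
      field_simp
      norm_num
    have e2 : 4 * (T + 1) * (h j - h i - 1) ^ 2 ≤ 1 / 4 := by
      have e3 : (h j - h i - 1) ^ 2 ≤ (1 / (4 * (T + 1))) ^ 2 := by
        rw [← sq_abs]
        gcongr
      calc 4 * ((T : ℝ) + 1) * (h j - h i - 1) ^ 2
            ≤ 4 * (T + 1) * (1 / (4 * (T + 1))) ^ 2 := by gcongr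
        _ = 1 / (4 * ((T : ℝ) + 1)) := by field_simp
        _ ≤ 1 / 4 := one_div_le_one_div_of_le (by norm_num) (by
          have : (0 : ℝ) ≤ T := by positivity
          linarith)
    have e4 : N * (N ^ 2 * (N ^ 2) ^ (i : ℕ) * ((N ^ 2) ^ (j : ℕ))⁻¹) ≤ 1 / 4 := by
      obtain ⟨e, he⟩ := Nat.exists_eq_add_of_lt hij
      have : N * (N ^ 2 * (N ^ 2) ^ (i : ℕ) * ((N ^ 2) ^ (j : ℕ))⁻¹) = N⁻¹ * ((N ^ 2) ^ e)⁻¹ := by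
        rw [he]
        field_simp
        ring
      rw [this]
      have h1 : N⁻¹ ≤ 1 / 4 := by
        rw [← one_div]
        exact one_div_le_one_div_of_le (by norm_num) h4
      have h2 : ((N ^ 2) ^ e)⁻¹ ≤ 1 := inv_le_one_of_one_le₀ (one_le_pow₀ hN1)
      exact (mul_le_of_le_one_right (by positivity) h2).trans h1
    unfold rightScore
    linarith
  refine lt_of_le_of_lt ?_ hj
  have s1 : 0 ≤ 4 * (T + 1) * (h j' - h i - 1) ^ 2 := by positivity
  have s2 : 0 ≤ N * (N ^ 2 * (N ^ 2) ^ (i : ℕ) * ((N ^ 2) ^ (j' : ℕ))⁻¹) := by positivity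
  have s3 : (0 : ℝ) ≤ (j' : ℕ) := by positivity
  unfold rightScore
  rcases le_or_gt (j' : ℕ) (i + 1) with hc | hc
  · obtain ⟨e, he⟩ := Nat.exists_eq_add_of_le hc
    have : N ^ 2 * (N ^ 2) ^ (i : ℕ) * ((N ^ 2) ^ (j' : ℕ))⁻¹ = (N ^ 2) ^ e := by
      have : N ^ 2 * (N ^ 2) ^ (i : ℕ) = (N ^ 2) ^ (j' : ℕ) * (N ^ 2) ^ e := by
        rw [← pow_add, ← he, pow_succ]
        ring
      rw [this]
      field_simp
    have h1 : 1 ≤ (N ^ 2) ^ e := one_le_pow₀ hN1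
    rw [this]
    nlinarith
  · by_cases hH : H j' = H i + 1
    · have h1 : (j : ℕ) < j' := by
        rcases lt_trichotomy (j' : ℕ) j with hl | hl | hl
        · exact absurd hH (hmin _ hc hl)
        · exact absurd (Fin.ext hl) hne
        · exact hl
      have h2 : (j : ℝ) + 1 ≤ (j' : ℕ) := by exact_mod_cast h1
      linarith
    · -- A wrong height is off by at least one, and the estimates by at most `1 / 4` in total.
      have h1 : (1 : ℝ) ≤ |(H j' - H i - 1 : ℝ)| := by
        have : (1 : ℤ) ≤ |H j' - H i - 1| := Int.one_le_abs (by omega)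
        exact_mod_cast this
      have h2 : (H j' - H i - 1 : ℝ) = (h j' - h i - 1) - (h j' - H j') + (h i - H i) := by ring
      have h3 : 3 / 4 ≤ |h j' - h i - 1| := by
        have h5 := (abs_add_le ((h j' - h i - 1) - (h j' - H j')) (h i - H i)).trans
          (add_le_add_left (abs_sub (h j' - h i - 1) (h j' - H j')) _)
        rw [← h2] at h5
        linarith [hh i, hh j']
      have h6 : (1 : ℝ) / 4 ≤ (h j' - h i - 1) ^ 2 := by
        rw [← sq_abs]
        nlinarith
      nlinarith


/-! ### Layout of the embeddings -/

/-- Names of the coordinates of an embedding: the state computed so far, which is the output; the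
vector of the symbol; room for the state of the right child between attention and feedforward block;
the indicator of opening brackets; the height and its square; the positional encoding. -/
inductive Coord (n : ℕ) where
  | state (a : Fin n)
  | leaf (a : Fin n)
  | right (a : Fin n)
  | isOpen
  | height
  | heightSq
  | pos (r : Fin 5)
  deriving DecidableEq

namespace Coord

variable {n : ℕ}

/-- The coordinates as a sum of index types, in the order in which a transformer stores them. -/
def equivSum (n : ℕ) : Coord n ≃ (Fin n ⊕ ((Fin n ⊕ Fin n) ⊕ Fin 3)) ⊕ Fin 5 where
  toFun
    | state a => .inl (.inl a)
    | leaf a => .inl (.inr (.inl (.inl a)))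
    | right a => .inl (.inr (.inl (.inr a)))
    | isOpen => .inl (.inr (.inr 0))
    | height => .inl (.inr (.inr 1))
    | heightSq => .inl (.inr (.inr 2))
    | pos r => .inr r
  invFun
    | .inl (.inl a) => state a
    | .inl (.inr (.inl (.inl a))) => leaf a
    | .inl (.inr (.inl (.inr a))) => right a
    | .inl (.inr (.inr r)) => ![isOpen, height, heightSq] r
    | .inr r => pos r
  left_inv c := by cases c <;> rfl
  right_inv c := by
    rcases c with (a | (a | a) | r) | r <;> try rfl
    fin_cases r <;> rfl

/-- The numbering of the coordinates. -/
def equivFin (n : ℕ) : Coord n ≃ Fin (n + (n + n + 3) + 5) :=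
  (equivSum n).trans <| (Equiv.sumCongr ((Equiv.sumCongr (Equiv.refl _)
    ((Equiv.sumCongr finSumFinEquiv (Equiv.refl _)).trans finSumFinEquiv)).trans finSumFinEquiv)
    (Equiv.refl _)).trans finSumFinEquiv

theorem exists_equivFin_eq_castAdd (c : Coord n) (h : ∀ r, c ≠ pos r) :
    ∃ c', equivFin n c = Fin.castAdd 5 c' := by
  cases c with
  | pos r => exact absurd rfl (h r)
  | _ => exact ⟨_, rfl⟩

instance : Fintype (Coord n) := Fintype.ofEquiv _ (equivFin n).symm

theorem card_eq : Fintype.card (Coord n) = n + (n + n + 3) + 5 := by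
  rw [Fintype.card_congr (equivFin n), Fintype.card_fin]

end Coord

/-- The matrix whose rows are given by named coordinates. -/
def embMat {n m : ℕ} (R : Fin m → Coord n → ℝ) : Matrix (Fin m) (Fin (n + (n + n + 3) + 5)) ℝ :=
  Matrix.of fun i c => R i ((Coord.equivFin n).symm c)

/-- The bilinear form with the listed coefficients. -/
def bilin {n : ℕ} (l : List (ℝ × Coord n × Coord n)) :
    Matrix (Fin (n + (n + n + 3) + 5)) (Fin (n + (n + n + 3) + 5)) ℝ :=
  (l.map fun p => Matrix.single (Coord.equivFin n p.2.1) (Coord.equivFin n p.2.2) p.1).sum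

theorem embMat_mul_bilin {n m : ℕ} (R : Fin m → Coord n → ℝ) (l : List (ℝ × Coord n × Coord n))
    (i j : Fin m) :
    (embMat R * bilin l * (embMat R).transpose) i j =
      (l.map fun p => p.1 * R i p.2.1 * R j p.2.2).sum := by
  induction l with
  | nil => simp [bilin]
  | cons p l ih =>
    have : bilin (p :: l) = Matrix.single (Coord.equivFin n p.2.1) (Coord.equivFin n p.2.2) p.1
        + bilin l := by simp [bilin]
    rw [this, Matrix.mul_add, Matrix.add_mul, Matrix.add_apply, ih, List.map_cons, List.sum_cons]
    congr 1
    rw [Matrix.mul_apply, Finset.sum_eq_single (Coord.equivFin n p.2.2)]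
    · rw [Matrix.mul_single_apply_same]
      simp [embMat, mul_comm]
    · intro c _ hc
      rw [Matrix.mul_single_apply_of_ne _ _ _ _ _ hc, zero_mul]
    · simp

/-- The products formed by the feedforward blocks: the gated products of two states, all
coordinates, and the two products that turn a mean weight into a height and its square. -/
abbrev Products (n : ℕ) : Type := (Fin n × Fin n) ⊕ (Coord n ⊕ Fin 2)

/-- The three factors of each product; the coordinate `pos 0` is constantly `1`. -/
def factors {n : ℕ} : Products n → Fin 3 → Coord n
  | .inl (a, b) => ![.isOpen, .state a, .right b]
  | .inr (.inl c) => ![c, .pos 0, .pos 0]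
  | .inr (.inr 0) => ![.pos 1, .height, .pos 0]
  | .inr (.inr 1) => ![.pos 2, .height, .height]

/-- A linear map of the products of a row. -/
def productRow {n : ℕ} (V : Products n → Coord n → ℝ) (r : Coord n → ℝ) (c : Coord n) : ℝ :=
  ∑ u, r (factors u 0) * r (factors u 1) * r (factors u 2) * V u c

/-- The limits of a layer, in named coordinates. -/
theorem embMat_productRow_mem_closure {I : Type*} {len : I → ℕ} {n : ℕ} {act : ℝ → ℝ}
    (hs : ContDiff ℝ ∞ act) {x₀ : ℝ} (hx : iteratedDeriv 3 act x₀ ≠ 0)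
    (R R' : (t : I) → Fin (len t) → Coord n → ℝ)
    (W : ℝ → Fin 3 → Matrix (Fin (n + (n + n + 3) + 5)) (Fin (n + (n + n + 3) + 5)) ℝ)
    (a : (t : I) → Fin 3 → Matrix (Fin (len t)) (Fin (len t)) ℝ)
    (ha : ∀ t q i j, Filter.Tendsto
      (fun l => rowSoftmax (embMat (R t) * W l q * (embMat (R t)).transpose) i j)
      Filter.atTop (nhds (a t q i j)))
    (hd : Coord n → Fin 3) (src : Coord n → Coord n) (V : Products n → Coord n → ℝ)
    (hR' : ∀ t i c, R' t i c =
      productRow V (fun c' => ∑ j, a t (hd c') i j * R t j (src c')) c) :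
    (fun t => embMat (R' t)) ∈ closure (reachable (n + (n + n + 3) + 5) 3
      (8 * Fintype.card (Products n)) act 1 fun t => embMat (R t)) := by
  have := tripleProducts_routedAttn_mem_closure hs hx (fun t => embMat (R t)) W a ha
    (fun c => hd ((Coord.equivFin n).symm c))
    (fun c => Coord.equivFin n (src ((Coord.equivFin n).symm c)))
    (fun (u : Products n) e => Coord.equivFin n (factors u e))
    (fun u c => V u ((Coord.equivFin n).symm c))
  convert this using 2 with t
  ext i c
  simp [embMat, tripleProducts, routedAttn, hR', productRow]

/-! ### The layers of the simulation -/

/-- The positional encoding with base `N`: the constant and the two monomials that make the squared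
distance of positions bilinear, and the two factors of the mask. -/
noncomputable def posEnc (N : ℝ) (i : ℕ) : Fin 5 → ℝ :=
  ![1, i, (i : ℝ) ^ 2, (N ^ 2) ^ i, ((N ^ 2) ^ i)⁻¹]

/-- The row of a position with symbol `b`, state `s`, entries `h` and `h₂` for its height and the
square of its height, and positional encoding `p`. -/
def rowOf {S : Type*} {n : ℕ} (A : WTA S n) (s : Fin n → ℝ) (b : BSym S) (h h₂ : ℝ)
    (p : Fin 5 → ℝ) : Coord n → ℝ
  | .state a => s a
  | .leaf a => A.symVec b a
  | .right _ => 0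
  | .isOpen => match b with
    | .opening => 1
    | _ => 0
  | .height => h
  | .heightSq => h₂
  | .pos r => p r

/-- The score `-(i - j) ^ 2`, with which a position attends to itself. -/
def selfForm (n : ℕ) : List (ℝ × Coord n × Coord n) :=
  [(-1, .pos 2, .pos 0), (2, .pos 1, .pos 1), (-1, .pos 0, .pos 2)]

/-- The score `-(i + 1 - j) ^ 2`, with which a position attends to the next one. -/
def nextForm (n : ℕ) : List (ℝ × Coord n × Coord n) :=
  [(-1, .pos 2, .pos 0), (-2, .pos 1, .pos 0), (-1, .pos 0, .pos 0), (2, .pos 1, .pos 1),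
    (2, .pos 0, .pos 1), (-1, .pos 0, .pos 2)]

/-- The score `maskScore`. -/
noncomputable def maskForm (n : ℕ) (N : ℝ) : List (ℝ × Coord n × Coord n) :=
  [(-(N⁻¹ * N ^ 2), .pos 4, .pos 3)]

/-- The score `rightScore`. -/
def rightForm (n T : ℕ) (N : ℝ) : List (ℝ × Coord n × Coord n) :=
  let K : ℝ := 4 * (T + 1)
  [(-K, .pos 0, .heightSq), (2 * K, .height, .height), (2 * K, .pos 0, .height),
    (-K, .heightSq, .pos 0), (-2 * K, .height, .pos 0), (-K, .pos 0, .pos 0),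
    (-(N * N ^ 2), .pos 3, .pos 4), (-1, .pos 0, .pos 1)]

/-- The scores of the three heads of the later layers. -/
def nextForms (n T : ℕ) (N : ℝ) : Fin 3 → List (ℝ × Coord n × Coord n) :=
  ![selfForm n, nextForm n, rightForm n T N]

/-- The head from which the first layer reads a coordinate. -/
def firstHead {n : ℕ} : Coord n → Fin 3
  | .height => 1
  | _ => 0

/-- The head from which the later layers read a coordinate. -/
def nextHead {n : ℕ} : Coord n → Fin 3
  | .state _ => 1
  | .right _ => 2
  | _ => 0

/-- The coordinate that the later layers read at the position chosen by `nextHead`. -/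
def nextSource {n : ℕ} : Coord n → Coord n
  | .right a => .state a
  | c => c

section

variable {n m : ℕ} {N : ℝ} {R : Fin m → Coord n → ℝ}

theorem hardmax_selfForm (hR : ∀ i r, R i (.pos r) = posEnc N i r) (i j : Fin m) :
    hardmax (embMat R * bilin (selfForm n) * (embMat R).transpose) i j =
      if j = i then 1 else 0 := by
  have hs : ∀ j : Fin m, (embMat R * bilin (selfForm n) * (embMat R).transpose) i j =
      -((i : ℝ) - j) ^ 2 := fun j => by
    simp [embMat_mul_bilin, selfForm, hR, posEnc]
    ring
  refine hardmax_of_unique _ _ _ (fun j hj => ?_) j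
  rw [hs, hs, sub_self, zero_pow two_ne_zero, neg_zero, neg_lt_zero]
  have : (i : ℝ) - j ≠ 0 := sub_ne_zero.2 fun h => hj (Fin.ext (by exact_mod_cast h.symm))
  exact sq_pos_iff.2 this

theorem hardmax_nextForm (hR : ∀ i r, R i (.pos r) = posEnc N i r) (i i' : Fin m)
    (hi : (i' : ℕ) = i + 1) (j : Fin m) :
    hardmax (embMat R * bilin (nextForm n) * (embMat R).transpose) i j =
      if j = i' then 1 else 0 := by
  have hs : ∀ j : Fin m, (embMat R * bilin (nextForm n) * (embMat R).transpose) i j =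
      -((i' : ℝ) - j) ^ 2 := fun j => by
    simp [embMat_mul_bilin, nextForm, hR, posEnc, hi]
    ring
  refine hardmax_of_unique _ _ _ (fun j hj => ?_) j
  rw [hs, hs, sub_self, zero_pow two_ne_zero, neg_zero, neg_lt_zero]
  have : (i' : ℝ) - j ≠ 0 := sub_ne_zero.2 fun h => hj (Fin.ext (by exact_mod_cast h.symm))
  exact sq_pos_iff.2 this

theorem rowSoftmax_maskForm (hR : ∀ i r, R i (.pos r) = posEnc N i r) :
    rowSoftmax (embMat R * bilin (maskForm n N) * (embMat R).transpose) = maskWeight N m := by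
  rw [maskWeight]
  congr 1
  ext i j
  simp [embMat_mul_bilin, maskForm, hR, posEnc, maskScore]
  ring

theorem embMat_rightForm (T : ℕ) (hR : ∀ i r, R i (.pos r) = posEnc N i r)
    (hsq : ∀ i, R i .heightSq = R i .height ^ 2) (i j : Fin m) :
    (embMat R * bilin (rightForm n T N) * (embMat R).transpose) i j =
      rightScore T N i j (R i .height) (R j .height) := by
  simp [embMat_mul_bilin, rightForm, hR, hsq, posEnc, rightScore]
  ring

end

/-- The feedforward block of the first layer: heights from mean weights, all other coordinates
unchanged, except that the room for the right child is left empty. -/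
def firstCoeff {n : ℕ} (u : Products n) : Coord n → ℝ
  | .right _ => 0
  | .height => if u = .inr (.inr 0) then 1 else 0
  | .heightSq => if u = .inr (.inr 1) then 1 else 0
  | c => if u = .inr (.inl c) then 1 else 0

/-- The feedforward block of the later layers: the transition of the automaton on the states
gathered by the attention heads at opening brackets, plus the vector of the symbol. -/
def nextCoeff {S : Type*} {n : ℕ} (A : WTA S n) (u : Products n) : Coord n → ℝ
  | .state q => match u with
    | .inl (a, b) => A.trans q a b
    | .inr v => if v = .inl (.leaf q) then 1 else 0
  | .right _ => 0
  | c => if u = .inr (.inl c) then 1 else 0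

section

variable {S : Type*} {n : ℕ} (A : WTA S n) (N : ℝ)

/-- The rows of the initial embedding of a string. The coordinate `height` holds the weight of the
symbol, which the first layer averages. -/
noncomputable def initRow (x : List (BSym S)) (i : Fin x.length) : Coord n → ℝ :=
  rowOf A (A.symVec (x.get i)) (x.get i) (x.get i).weight 0 (posEnc N i)

/-- The rows of the limit of the embeddings after `1 + k` layers. -/
noncomputable def limitRow (k : ℕ) (x : List (BSym S)) (i : Fin x.length) : Coord n → ℝ :=
  rowOf A (A.stateAt k x i) (x.get i) (approxHeight N x i) (approxHeight N x i ^ 2) (posEnc N i)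

/-- The limits of the attention weights of the first layer. -/
noncomputable def firstWeight (x : List (BSym S)) :
    Fin 3 → Matrix (Fin x.length) (Fin x.length) ℝ :=
  ![hardmax (embMat (initRow A N x) * bilin (selfForm n) * (embMat (initRow A N x)).transpose),
    maskWeight N x.length, rowSoftmax 0]

variable {act : ℝ → ℝ} (hs : ContDiff ℝ ∞ act) {x₀ : ℝ} (hx : iteratedDeriv 3 act x₀ ≠ 0)
  {I : Type*} (tree : I → LTree S)

include hs hx

theorem limitRow_zero_mem_closure :
    (fun t => embMat (limitRow A N 0 (tree t).str)) ∈ closure (reachable (n + (n + n + 3) + 5) 3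
      (8 * Fintype.card (Products n)) act 1 fun t => embMat (initRow A N (tree t).str)) := by
  refine embMat_productRow_mem_closure hs hx _ _
    (fun l => ![l • bilin (selfForm n), bilin (maskForm n N), 0])
    (fun t => firstWeight A N (tree t).str)
    (fun t q i j => ?_) firstHead id firstCoeff (fun t i c => ?_)
  · fin_cases q
    · simpa [firstWeight] using tendsto_rowSoftmax_hardmax _ i j
    · simp [firstWeight,
        rowSoftmax_maskForm (N := N) (R := initRow A N (tree t).str) fun _ _ => rfl]
    · have h0 : embMat (initRow A N (tree t).str) *
          (0 : Matrix (Fin (n + (n + n + 3) + 5)) (Fin (n + (n + n + 3) + 5)) ℝ) *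
          (embMat (initRow A N (tree t).str)).transpose = 0 := by
        rw [Matrix.mul_zero, Matrix.zero_mul]
      exact tendsto_const_nhds.congr fun _ => congrFun₂ (congrArg rowSoftmax h0.symm) i j
  · have hself : ∀ c, ∑ j, firstWeight A N (tree t).str 0 i j * initRow A N (tree t).str j c =
        initRow A N (tree t).str i c := fun c => by
      have h1 : ∀ j, firstWeight A N (tree t).str 0 i j = if j = i then 1 else 0 :=
        hardmax_selfForm (N := N) (R := initRow A N (tree t).str) (fun _ _ => rfl) i
      simp [h1]
    have hstate : A.stateAt 0 (tree t).str i = A.symVec ((tree t).str.get i) := by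
      by_cases h : (tree t).str.get i = .opening
      · rw [(A.stateAt_of_opening _ i h).1, h]
        rfl
      · exact A.stateAt_of_ne_opening 0 i h
    have hone : initRow A N (tree t).str i (.pos 0) = 1 := rfl
    have hmean : initRow A N (tree t).str i (.pos 1) *
        ∑ j, firstWeight A N (tree t).str 1 i j * initRow A N (tree t).str j .height =
        approxHeight N (tree t).str i := rfl
    have hsq : initRow A N (tree t).str i (.pos 2) = initRow A N (tree t).str i (.pos 1) ^ 2 := rfl
    have hone : initRow A N (tree t).str i (.pos 0) = 1 := rfl
    cases c with
    | state a =>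
      simp [productRow, firstHead, firstCoeff, factors, hself, hone]
      exact congrFun hstate a
    | height =>
      simp [productRow, firstHead, firstCoeff, factors, hself, hone, hmean]
      rfl
    | heightSq =>
      have : limitRow A N 0 (tree t).str i .heightSq = approxHeight N (tree t).str i ^ 2 := rfl
      simp [productRow, firstHead, firstCoeff, factors, hself, hsq, this, ← hmean]
      ring
    | _ =>
      simp [productRow, firstHead, firstCoeff, factors, hself, hone]
      rfl

/-- Given estimates of the heights that are good enough, one more layer evaluates the nodes one
level further up. -/
theorem limitRow_succ_mem_closure {T : ℕ} (h4 : 4 ≤ N) (hT : (T + 1 : ℝ) < N)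
    (hN : ∀ m ≤ T, ∀ i j : Fin m,
      |(i : ℝ) * maskWeight N m i j - if j < i then 1 else 0| ≤ 1 / (8 * (T + 1) ^ 2))
    (hlen : ∀ t, (tree t).str.length ≤ T) (k : ℕ) :
    (fun t => embMat (limitRow A N (k + 1) (tree t).str)) ∈
      closure (reachable (n + (n + n + 3) + 5) 3
        (8 * Fintype.card (Products n)) act 1 fun t => embMat (limitRow A N k (tree t).str)) := by
  refine embMat_productRow_mem_closure hs hx _ _
    (fun l q => l • bilin (nextForms n T N q))
    (fun t q => hardmax (embMat (limitRow A N k (tree t).str) *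
      bilin (nextForms n T N q) *
      (embMat (limitRow A N k (tree t).str)).transpose))
    (fun t q i j => ?_)
    nextHead nextSource (nextCoeff A) (fun t i c => ?_)
  · simpa using tendsto_rowSoftmax_hardmax _ i j
  · set R := limitRow A N k (tree t).str with hRdef
    have hR : ∀ i r, R i (.pos r) = posEnc N i r := fun _ _ => rfl
    have hself : ∀ c, ∑ j, hardmax (embMat R * bilin (selfForm n) *
        (embMat R).transpose) i j * R j c = R i c := fun c => by
      simp [hardmax_selfForm (N := N) hR]
    have hone : R i (.pos 0) = 1 := rfl
    have hf0 : nextForms n T N 0 = selfForm n := rfl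
    have hf1 : nextForms n T N 1 = nextForm n := rfl
    have hf2 : nextForms n T N 2 = rightForm n T N := rfl
    cases c with
    | state q =>
      by_cases h : (tree t).str.get i = .opening
      · obtain ⟨_, j, hij, hj, hmin, hst⟩ := A.stateAt_of_opening (tree t) i h
        have hnext : ∀ c, ∑ j, hardmax (embMat R * bilin (nextForm n) *
            (embMat R).transpose) i j * R j c = R ⟨i + 1, by omega⟩ c := fun c => by
          simp [hardmax_nextForm (N := N) hR i ⟨i + 1, by omega⟩ rfl]
        have hright : ∀ c, ∑ j, hardmax (embMat R * bilin (rightForm n T N) *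
            (embMat R).transpose) i j * R j c = R j c := fun c => by
          have hm : ∀ j', hardmax (embMat R * bilin (rightForm n T N) *
              (embMat R).transpose) i j' = if j' = j then 1 else 0 := by
            refine hardmax_of_unique _ _ _ fun j' hne => ?_
            rw [embMat_rightForm T hR fun _ => rfl, embMat_rightForm T hR fun _ => rfl]
            exact rightScore_lt h4 hT (hlen t) (H := height (tree t).str)
              (fun i => abs_approxHeight_sub_le _ (hlen t) hN i) hij hj hmin j' hne
          simp [hm]
        have hop : R i .isOpen = 1 := by
          simp only [hRdef, limitRow, rowOf, h]
        have hleaf : R i (.leaf q) = 0 := by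
          simp only [hRdef, limitRow, rowOf, h]
          rfl
        simp [productRow, nextHead, nextSource, nextCoeff, factors, hf0, hf1, hf2, hself,
          hnext, hright, hop, hleaf, hone, Fintype.sum_prod_type]
        simp only [hRdef, limitRow, rowOf, hst k q]
        exact Finset.sum_congr rfl fun a _ => Finset.sum_congr rfl fun b _ => by ring
      · -- The gate vanishes, so it does not matter what the heads for the children attend to.
        have hop : R i .isOpen = 0 := by
          simp only [hRdef, limitRow, rowOf]
        simp [productRow, nextHead, nextSource, nextCoeff, factors, hf0, hself, hop, hone]
        simp only [hRdef, limitRow, rowOf, A.stateAt_of_ne_opening (k + 1) i h]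
    | _ =>
      simp [productRow, nextHead, nextSource, nextCoeff, factors, hf0, hself, hone]
      try rfl

theorem limitRow_mem_closure {T : ℕ} (h4 : 4 ≤ N) (hT : (T + 1 : ℝ) < N)
    (hN : ∀ m ≤ T, ∀ i j : Fin m,
      |(i : ℝ) * maskWeight N m i j - if j < i then 1 else 0| ≤ 1 / (8 * (T + 1) ^ 2))
    (hlen : ∀ t, (tree t).str.length ≤ T) (k : ℕ) :
    (fun t => embMat (limitRow A N k (tree t).str)) ∈ closure (reachable (n + (n + n + 3) + 5) 3
      (8 * Fintype.card (Products n)) act (1 + k) fun t =>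
        embMat (initRow A N (tree t).str)) := by
  induction k with
  | zero => exact limitRow_zero_mem_closure A N hs hx tree
  | succ k ih =>
    exact closure_reachable_trans (L := 1 + k) hs.continuous ih
      (limitRow_succ_mem_closure A N hs hx tree h4 hT hN hlen k)

end

/-! ### The transformer -/

/-- The transformer with the given layers and the token embedding of the simulation. -/
noncomputable def simTransformer {S : Type*} {n : ℕ} (A : WTA S n)
    (Ls : List (TLayer (n + (n + n + 3) + 5) (n + (n + n + 3) + 5) 3
      (8 * Fintype.card (Products n)))) : Transformer S n 5 where
  q := n + n + 3
  attnWidth := n + (n + n + 3) + 5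
  numHeads := 3
  mlpWidth := 8 * Fintype.card (Products n)
  tok b c := rowOf A (A.symVec b) b b.weight 0 0 ((Coord.equivFin n).symm (Fin.castAdd 5 c))
  layers := Ls

section

variable {S : Type*} {n : ℕ} (A : WTA S n)
  (Ls : List (TLayer (n + (n + n + 3) + 5) (n + (n + n + 3) + 5) 3
    (8 * Fintype.card (Products n))))

theorem simTransformer_embed (N : ℝ) (x : List (BSym S)) :
    (simTransformer A Ls).embed (posEnc N) x = embMat (initRow A N x) := by
  ext i c
  obtain ⟨c, rfl⟩ := (Coord.equivFin n).surjective c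
  simp only [embMat, Matrix.of_apply, Equiv.symm_apply_apply, initRow]
  by_cases hc : ∃ r, c = .pos r
  · obtain ⟨r, rfl⟩ := hc
    exact Fin.append_right _ _ r
  · push Not at hc
    obtain ⟨c', hc'⟩ := c.exists_equivFin_eq_castAdd hc
    rw [hc']
    refine (Fin.append_left _ _ c').trans ?_
    simp only [simTransformer]
    rw [← hc', Equiv.symm_apply_apply]
    cases c with
    | pos r => exact absurd rfl (hc r)
    | _ => rfl

theorem simTransformer_eval (act : ℝ → ℝ) (N : ℝ) (x : List (BSym S)) (i : Fin x.length)
    (c : Fin n) : (simTransformer A Ls).eval act (posEnc N) x i c =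
      runLayers act Ls (embMat (initRow A N x)) i (Coord.equivFin n (.state c)) := by
  rw [← simTransformer_embed A Ls]
  rfl

theorem simTransformer_sizeAtMost (hn : 1 ≤ n) : (simTransformer A Ls).SizeAtMost 112 := by
  have h1 : n ≤ n ^ 2 := Nat.le_self_pow two_ne_zero n
  have h2 : (simTransformer A Ls).mlpWidth = 8 * (n ^ 2 + (n + (n + n + 3) + 5 + 2)) := by
    simp only [simTransformer, Fintype.card_sum, Fintype.card_prod, Fintype.card_fin,
      Coord.card_eq]
    ring
  refine ⟨?_, ?_, ?_, ?_⟩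
  · simp only [Transformer.embedDim, simTransformer]
    omega
  · simp only [simTransformer]
    omega
  · rw [h2]
    omega
  · simp only [simTransformer]
    omega

end

/-- Simulation of all trees of depth at most `D` by `1 + D` layers. -/
theorem exists_simulation {S : Type*} [Finite S] {n : ℕ} (A : WTA S n) {act : ℝ → ℝ}
    (hs : ContDiff ℝ ∞ act) {x₀ : ℝ} (hx : iteratedDeriv 3 act x₀ ≠ 0) {T : ℕ} {N : ℝ}
    (h4 : 4 ≤ N) (hT : (T + 1 : ℝ) < N)
    (hN : ∀ m ≤ T, ∀ i j : Fin m,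
      |(i : ℝ) * maskWeight N m i j - if j < i then 1 else 0| ≤ 1 / (8 * (T + 1) ^ 2))
    {ε : ℝ} (hε : 0 < ε) (D : ℕ) :
    ∃ Ls, Ls.length = 1 + D ∧ ApproxSimulatesOn {t | t.depth ≤ D} A T ε
      ((simTransformer A Ls).eval act (posEnc N)) := by
  let I := {t : LTree S // t.str.length ≤ T ∧ t.depth ≤ D}
  have : Finite {t : LTree S // t.str.length ≤ T} := LTree.finite_length_le T
  have : Finite I := Finite.of_injective
    (fun t : I => (⟨t.1, t.2.1⟩ : {t : LTree S // t.str.length ≤ T}))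
    fun s t h => Subtype.ext (congrArg (fun z => z.1) h)
  let err : ((t : I) → Matrix (Fin t.1.str.length) (Fin (n + (n + n + 3) + 5)) ℝ) → I → ℝ :=
    fun Y t => Real.sqrt (∑ i : t.1.starts, ∑ c,
      (Y t i.1 (Coord.equivFin n (.state c)) - A.mu (t.1.subtreeAt i) c) ^ 2)
  have hcont : ∀ t, Continuous fun Y => err Y t := fun t => by
    refine Real.continuous_sqrt.comp ?_
    refine continuous_finsetSum _ fun i _ => continuous_finsetSum _ fun c _ => ?_
    exact (((continuous_apply t).matrix_elem _ _).sub continuous_const).pow 2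
  have hopen : IsOpen {Y | ∀ t, err Y t < ε} := by
    rw [Set.ofPred_forall]
    exact isOpen_iInter_of_finite fun t => isOpen_lt (hcont t) continuous_const
  have hmem := limitRow_mem_closure A N hs hx (fun t : I => t.1) h4 hT hN (fun t => t.2.1) D
  obtain ⟨_, hY, Ls, hLs, rfl⟩ := mem_closure_iff.1 hmem _ hopen fun t => by
    have : err (fun t => embMat (limitRow A N D t.1.str)) t = 0 := by
      refine Real.sqrt_eq_zero'.2 (le_of_eq (Finset.sum_eq_zero fun i _ =>
        Finset.sum_eq_zero fun c _ => ?_))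
      have hp : (t.1.subtreeAt i).str <+: t.1.str.drop i.1 :=
        (LTree.existsUnique_str_prefix t.1 i).choose_spec.1
      have hd := (LTree.depth_le_of_prefix t.1 i.1 _ i.1.2 hp).trans t.2.2
      simp [embMat, limitRow, rowOf, A.stateAt_eq hp, A.truncMu_eq_mu _ _ hd]
    rw [this]
    exact hε
  refine ⟨Ls, hLs, fun t ht hlen => ?_⟩
  simp only [simTransformer_eval]
  exact hY ⟨t, hlen, ht⟩


theorem theorem3 :
    ∃ (C p : ℕ) (pos : ℕ → ℕ → Fin p → ℝ),
      ∀ (act : ℝ → ℝ), ContDiff ℝ ∞ act →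
        (¬ ∃ P : Polynomial ℝ, P.natDegree ≤ 3 ∧ ∀ x, act x = P.eval x) →
      ∀ (S : Type*) [Finite S] (n : ℕ), 1 ≤ n → ∀ (A : WTA S n) (T : ℕ) (ε : ℝ), 0 < ε →
        (∀ D : ℕ, ∃ f : Transformer S n p, f.SizeAtMost C ∧ f.depth = 1 + D ∧
          ApproxSimulatesOn {t | t.depth ≤ D} A T ε (f.eval act (pos T))) ∧
        (∃ f : Transformer S n p, f.SizeAtMost C ∧ f.depth ≤ C * T ∧
          ApproxSimulatesOn Set.univ A T ε (f.eval act (pos T))) ∧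
        (∀ κ : ℝ, 0 ≤ κ → 2 ≤ T → ∃ f : Transformer S n p, f.SizeAtMost C ∧
          (f.depth : ℝ) ≤ C * (κ + 1) * Real.log T ∧
          ApproxSimulatesOn {t | (t.depth : ℝ) ≤ κ * Real.log T} A T ε
            (f.eval act (pos T))) := by
  choose N h4 hT hN using exists_maskBase
  refine ⟨112, 5, fun T => posEnc (N T), ?_⟩
  intro act hs hp S _ n hn A T ε hε
  obtain ⟨x₀, hx⟩ := exists_iteratedDeriv_three_ne_zero hs hp
  have main := exists_simulation A hs hx (h4 T) (hT T) (hN T) hε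
  refine ⟨fun D => ?_, ?_, fun κ hκ hT2 => ?_⟩
  · obtain ⟨Ls, hLs, h⟩ := main D
    exact ⟨simTransformer A Ls, simTransformer_sizeAtMost A Ls hn, hLs, h⟩
  · rcases Nat.eq_zero_or_pos T with rfl | hT0
    · -- No tree has a representation of length `0`.
      refine ⟨simTransformer A [], simTransformer_sizeAtMost A [] hn, le_rfl, fun t _ hlen => ?_⟩
      exact absurd (str_length_pos t) (by omega)
    · obtain ⟨Ls, hLs, h⟩ := main (T - 1)
      refine ⟨simTransformer A Ls, simTransformer_sizeAtMost A Ls hn, ?_, fun t _ hlen => ?_⟩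
      · have : (simTransformer A Ls).depth = 1 + (T - 1) := hLs
        omega
      · refine h t ?_ hlen
        have := t.depth_lt_length
        simp only [Set.mem_ofPred_eq]
        omega
  · obtain ⟨Ls, hLs, h⟩ := main ⌊κ * Real.log T⌋₊
    have hlog : Real.log 2 ≤ Real.log T :=
      Real.log_le_log (by norm_num) (by exact_mod_cast hT2)
    have hlog2 := Real.log_two_gt_d9
    have hκl : 0 ≤ κ * Real.log T := mul_nonneg hκ (by linarith)
    refine ⟨simTransformer A Ls, simTransformer_sizeAtMost A Ls hn, ?_, fun t ht hlen => ?_⟩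
    · have : (simTransformer A Ls).depth = 1 + ⌊κ * Real.log T⌋₊ := hLs
      rw [this]
      push_cast
      linarith [Nat.floor_le hκl]
    · exact h t (Nat.le_floor ht) hlen
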